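/- Let $\mathcal H$ be a complex Hilbert space, and let $T,T'\in\mathcal B(\mathcal H)$ be contractions ($\|T\|\le 1$, $\|T'\|\le 1$). For a contraction $A$ on $\mathcal H$ put $D_A=(I-A^*A)^{1/2}$ and $\mathcal D_A=\overline{D_A\mathcal H}$. For contractions $A,B$ on $\mathcal H$: - $A$ is *Harnack dominated* by $B$ if there is a constant $c\ge 1$ such that $\operatorname{Re}p(A)\le c\,\operatorname{Re}p(B)$ for every complex polynomial $p$ with $\operatorname{Re}p(z)\ge 0$ for all $|z|\le 1$, where $\operatorname{Re}X=\frac12(X+X^*)$; $A$ and $B$ are *Harnack equivalent* if each is Harnack dominated by the other. - $A$ is *Shmul'yan dominated* by $B$ if $A=B+D_{B^*}XD_B$ for some bounded operator $X:\mathcal D_B\to\mathcal D_{B^*}$; $A$ and $B$ are *Shmul'yan equivalent* if each is Shmul'yan dominated by the other. Suppose that $T^*$ is quasi-normal (that is, $T^*$ commutes with $TT^*$), that $T$ commutes with $T'$ and with $T'^*T'$, and that $T'$ commutes with $TT^*$. Then the following are equivalent: 1. $T$ is Harnack dominated by $T'$; 2. $T$ is Harnack equivalent to $T'$; 3. $T$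 is Shmul'yan equivalent to $T'$; 4. there exist a point $z_0$ of the open unit disc $\mathbb D$ and an analytic function $F:\mathbb D\to\mathcal B(\mathcal H)$ with $\|F(z)\|\le 1$ for all $z\in\mathbb D$, such that $F(0)=T$ and $F(z_0)=T'$; 5. there exists a bounded operator $B:\ell^2_{\mathbb N}(\mathcal D_{T'})\to\mathcal H$ such that $$T=T'+BJ'D_{T'}\quad\text{and}\quad BS'=TB,$$ where $J':\mathcal D_{T'}\to\ell^2_{\mathbb N}(\mathcal D_{T'})$, $x\mapsto(x,0,0,\dots)$, is the canonical inclusion and $S'$ is the forward shift $(x_0,x_1,\dots)\mapsto(0,x_0,x_1,\dots)$ on $\ell^2_{\mathbb N}(\mathcal D_{T'})$. -/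

import Mathlib

open scoped ComplexStarModule ENNReal InnerProductSpace

namespace HarnackShmulyan

noncomputable section

variable {H₁ H₂ H : Type*}
  [NormedAddCommGroup H₁] [InnerProductSpace ℂ H₁] [CompleteSpace H₁]
  [NormedAddCommGroup H₂] [InnerProductSpace ℂ H₂] [CompleteSpace H₂]
  [NormedAddCommGroup H] [InnerProductSpace ℂ H] [CompleteSpace H]

/-- `A` is quasi-normal if it commutes with `A* A`. -/
def IsQuasiNormal (A : H →L[ℂ] H) : Prop :=
  Commute A (A.adjoint * A)

/-- `T` is Harnack dominated by `T'`: there is a constant `c ≥ 1` such that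
`Re p(T) ≤ c Re p(T')` (in the order of self-adjoint operators) for every polynomial `p` with
`Re p ≥ 0` on the closed unit disc. -/
def HarnackDominated (T T' : H →L[ℂ] H) : Prop :=
  ∃ c : ℝ, 1 ≤ c ∧ ∀ p : Polynomial ℂ, (∀ z : ℂ, ‖z‖ ≤ 1 → 0 ≤ (p.eval z).re) →
    (ℜ (Polynomial.aeval T p) : H →L[ℂ] H) ≤ c • (ℜ (Polynomial.aeval T' p) : H →L[ℂ] H)

/-- `T` and `T'` Harnack dominate each other. -/
def HarnackEquivalent (T T' : H →L[ℂ] H) : Prop :=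
  HarnackDominated T T' ∧ HarnackDominated T' T

/-- The defect operator `D_A = (I - A* A)^{1/2}`. -/
def defectOp (A : H₁ →L[ℂ] H₂) : H₁ →L[ℂ] H₁ :=
  CFC.sqrt (1 - A.adjoint ∘L A)

/-- The defect space: the closure of the range of the defect operator. -/
def defectSpace (A : H₁ →L[ℂ] H₂) : Submodule ℂ H₁ :=
  (defectOp A).range.topologicalClosure

/-- The defect operator viewed as an operator from `H₁` into the defect space. -/
def defectMap (A : H₁ →L[ℂ] H₂) : H₁ →L[ℂ] defectSpace A :=
  (defectOp A).codRestrict (defectSpace A)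
    fun x => Submodule.le_topologicalClosure _ ⟨x, rfl⟩

/-- The defect operator viewed as an operator from the defect space into `H₁`. -/
def defectRestr (A : H₁ →L[ℂ] H₂) : defectSpace A →L[ℂ] H₁ :=
  defectOp A ∘L (defectSpace A).subtypeL

/-- `B` is Shmul'yan dominated by `A`: `B = A + D_{A*} X D_A` for some bounded operator `X` from
the defect space of `A` to the defect space of `A*`. -/
def ShmulyanDominated (B A : H₁ →L[ℂ] H₂) : Prop :=
  ∃ X : defectSpace A →L[ℂ] defectSpace A.adjoint,
    B = A + defectRestr A.adjoint ∘L X ∘L defectMap A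

/-- `A` and `B` Shmul'yan dominate each other. -/
def ShmulyanEquivalent (A B : H₁ →L[ℂ] H₂) : Prop :=
  ShmulyanDominated A B ∧ ShmulyanDominated B A

/-- The space `ℓ²_ℕ(E)` of square summable sequences in `E`. -/
abbrev SeqSpace (E : Type*) [NormedAddCommGroup E] : Type _ := lp (fun _ : ℕ => E) 2

/-- The sequence `(0, f 0, f 1, …)`. -/
def shiftFun {E : Type*} [NormedAddCommGroup E] (f : ℕ → E) : ℕ → E
  | 0 => 0
  | n + 1 => f n

theorem hasSum_shiftFun {E : Type*} [NormedAddCommGroup E] (f : SeqSpace E) :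
    HasSum (fun n => ‖shiftFun f n‖ ^ (2 : ℝ≥0∞).toReal) (‖f‖ ^ (2 : ℝ≥0∞).toReal) := by
  have h := lp.hasSum_norm (p := 2) (by norm_num) f
  rw [← hasSum_nat_add_iff' 1]
  simpa [shiftFun] using h

theorem memℓp_shiftFun {E : Type*} [NormedAddCommGroup E] (f : SeqSpace E) : Memℓp (shiftFun f) 2 :=
  memℓp_gen (hasSum_shiftFun f).summable

/-- The forward shift `(f 0, f 1, …) ↦ (0, f 0, f 1, …)` on `ℓ²_ℕ(E)`. -/
def shift (E : Type*) [NormedAddCommGroup E] [InnerProductSpace ℂ E] :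
    SeqSpace E →L[ℂ] SeqSpace E :=
  LinearMap.mkContinuous
    { toFun := fun f => ⟨shiftFun f, memℓp_shiftFun f⟩
      map_add' := fun f g => by
        ext n
        cases n with
        | zero => exact (add_zero (0 : E)).symm
        | succ n => rfl
      map_smul' := fun a f => by
        ext n
        cases n <;> simp [shiftFun] }
    1 fun f => by
      have h := lp.hasSum_norm (p := 2) (by norm_num)
        (⟨shiftFun f, memℓp_shiftFun f⟩ : SeqSpace E)
      have h' := h.unique (hasSum_shiftFun f)
      rw [one_mul]
      exact le_of_eq ((Real.rpow_left_inj (norm_nonneg _) (norm_nonneg _) (by norm_num)).1 h')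

/-- The canonical inclusion `x ↦ (x, 0, 0, …)` of `E` into `ℓ²_ℕ(E)`. -/
def inclZero (E : Type*) [NormedAddCommGroup E] [InnerProductSpace ℂ E] : E →L[ℂ] SeqSpace E :=
  lp.singleContinuousLinearMap ℂ (fun _ : ℕ => E) 2 0

end

end HarnackShmulyan

namespace HarnackShmulyan

/-! The implications run 1 ⇒ 5 ⇒ 3 ⇒ 4 ⇒ 2 ⇒ 1. The commutation relations do their work in 5 ⇒ 3;
the other steps rest on general facts about contractions.

1 ⇒ 5: Harnack domination, tested on Fejér polynomials and averaged over roots of unity, becomes an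
inequality `Q_T ≤ c Q_{T'}` between Toeplitz forms (`toeplitzForm_le`). At the sequence `s m - T' (s
(m + 1))` the right side collapses to a sum of `‖D_{T'} s (m + 1)‖²`, and the left side dominates
`‖∑ Tᵏ (T - T') s (k + 1)‖²`. Hence `T - T' = B₀ D_{T'}`, and the row `(B₀, T B₀, T² B₀, …)` is a
bounded `B` (`exists_shift_intertwining`).

5 ⇒ 3: `B* h` has coordinates `B₀* T*ⁿ h`. Commutation lets `D_{T*}` pass through them, so the
square sum at `D_{T*} h` telescopes and yields `‖B₀* h‖ ≤ ‖B‖ ‖D_{T*} h‖`. By Douglas factorization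
`T - T' = D_{T*} Z D_{T'}`, a mixed form from which both Shmul'yan dominations follow
(`shmulyanEquivalent_of_sub_eq`).

3 ⇒ 4: on the complex line through `T` and `T'`, the unit ball contains a neighbourhood of the
segment between them; a thin analytic disc joins the endpoints inside it.

4 ⇒ 2: by von Neumann's inequality `Re ⟪x, p(F z) x⟫` is a nonnegative harmonic function of `z`, so
the scalar Harnack inequalities apply with a constant depending only on `‖z₀‖`. -/

theorem norm_apply_le_of_contraction {E F : Type*} [NormedAddCommGroup E] [NormedSpace ℂ E]
    [NormedAddCommGroup F] [NormedSpace ℂ F] {A : E →L[ℂ] F} (hA : ‖A‖ ≤ 1) (h : E) :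
    ‖A h‖ ≤ ‖h‖ :=
  (A.le_of_opNorm_le hA h).trans_eq (one_mul _)

/-! ### Defect operators and factorization through them -/

section Defect

variable {H₁ H₂ H : Type*}
  [NormedAddCommGroup H₁] [InnerProductSpace ℂ H₁] [CompleteSpace H₁]
  [NormedAddCommGroup H₂] [InnerProductSpace ℂ H₂] [CompleteSpace H₂]
  [NormedAddCommGroup H] [InnerProductSpace ℂ H] [CompleteSpace H]

instance completeSpace_defectSpace (A : H₁ →L[ℂ] H₂) : CompleteSpace (defectSpace A) :=
  inferInstanceAs (CompleteSpace (defectOp A).range.topologicalClosure)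

theorem norm_adjoint_le_one {A : H₁ →L[ℂ] H₂} (hA : ‖A‖ ≤ 1) : ‖A.adjoint‖ ≤ 1 := by
  rwa [LinearIsometryEquiv.norm_map]

theorem one_sub_adjoint_comp_nonneg {A : H₁ →L[ℂ] H₂} (hA : ‖A‖ ≤ 1) :
    0 ≤ 1 - A.adjoint ∘L A := by
  rw [ContinuousLinearMap.nonneg_iff_isPositive, ContinuousLinearMap.isPositive_iff_complex]
  intro x
  have h1 : ⟪(1 - A.adjoint ∘L A) x, x⟫_ℂ = ((‖x‖ ^ 2 - ‖A x‖ ^ 2 : ℝ) : ℂ) := by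
    simp [ContinuousLinearMap.adjoint_inner_left, inner_self_eq_norm_sq_to_K]
  rw [h1]
  refine ⟨by simp [-Complex.ofReal_pow], ?_⟩
  have := norm_apply_le_of_contraction hA x
  have h2 := pow_le_pow_left₀ (norm_nonneg _) this 2
  rw [RCLike.re_to_complex, Complex.ofReal_re]
  linarith

theorem isSelfAdjoint_defectOp (A : H₁ →L[ℂ] H₂) : IsSelfAdjoint (defectOp A) :=
  (CFC.sqrt_nonneg _).isSelfAdjoint

theorem inner_defectOp_left (A : H₁ →L[ℂ] H₂) (x y : H₁) :
    ⟪defectOp A x, y⟫_ℂ = ⟪x, defectOp A y⟫_ℂ := by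
  rw [← ContinuousLinearMap.adjoint_inner_right, (isSelfAdjoint_defectOp A).adjoint_eq]

theorem norm_defectOp_sq {A : H₁ →L[ℂ] H₂} (hA : ‖A‖ ≤ 1) (h : H₁) :
    ‖defectOp A h‖ ^ 2 = ‖h‖ ^ 2 - ‖A h‖ ^ 2 := by
  have h1 : defectOp A (defectOp A h) = (1 - A.adjoint ∘L A) h := by
    have := CFC.sqrt_mul_sqrt_self _ (one_sub_adjoint_comp_nonneg hA)
    exact congrArg (fun S : H₁ →L[ℂ] H₁ => S h) this
  have h2 : (‖defectOp A h‖ ^ 2 : ℂ) = ((‖h‖ ^ 2 - ‖A h‖ ^ 2 : ℝ) : ℂ) := by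
    have := inner_self_eq_norm_sq_to_K (𝕜 := ℂ) (defectOp A h)
    rw [inner_defectOp_left, h1] at this
    rw [← RCLike.ofReal_eq_complex_ofReal, ← this]
    simp [ContinuousLinearMap.adjoint_inner_right, inner_self_eq_norm_sq_to_K]
  exact_mod_cast h2

theorem norm_defectOp_le {A : H₁ →L[ℂ] H₂} (hA : ‖A‖ ≤ 1) (h : H₁) : ‖defectOp A h‖ ≤ ‖h‖ := by
  refine le_of_sq_le_sq ?_ (norm_nonneg _)
  rw [norm_defectOp_sq hA]
  linarith [sq_nonneg ‖A h‖]

/-- `‖D_{A*} A h‖ ≤ ‖D_A h‖`, a consequence of `D_{A*} A = A D_A`. -/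
theorem norm_defectOp_adjoint_apply_le {A : H₁ →L[ℂ] H₂} (hA : ‖A‖ ≤ 1) (h : H₁) :
    ‖defectOp A.adjoint (A h)‖ ≤ ‖defectOp A h‖ := by
  refine le_of_sq_le_sq ?_ (norm_nonneg _)
  rw [norm_defectOp_sq hA, norm_defectOp_sq (norm_adjoint_le_one hA)]
  have h1 : ‖A h‖ ^ 2 ≤ ‖A.adjoint (A h)‖ * ‖h‖ := by
    have h2 : (‖A h‖ ^ 2 : ℝ) = RCLike.re ⟪A.adjoint (A h), h⟫_ℂ := by
      rw [ContinuousLinearMap.adjoint_inner_left, inner_self_eq_norm_sq]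
    rw [h2]
    exact (RCLike.re_le_norm _).trans (norm_inner_le_norm _ _)
  nlinarith [sq_nonneg (‖A.adjoint (A h)‖ - ‖h‖)]

theorem norm_adjoint_defectOp_apply_le {A : H₁ →L[ℂ] H₂} (hA : ‖A‖ ≤ 1) (h : H₂) :
    ‖defectOp A (A.adjoint h)‖ ≤ ‖defectOp A.adjoint h‖ := by
  simpa only [ContinuousLinearMap.adjoint_adjoint] using
    norm_defectOp_adjoint_apply_le (norm_adjoint_le_one hA) h

@[simp]
theorem coe_defectMap (A : H₁ →L[ℂ] H₂) (h : H₁) : (defectMap A h : H₁) = defectOp A h := rfl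

@[simp]
theorem norm_defectMap (A : H₁ →L[ℂ] H₂) (h : H₁) : ‖defectMap A h‖ = ‖defectOp A h‖ := rfl

@[simp]
theorem defectRestr_apply (A : H₁ →L[ℂ] H₂) (x : defectSpace A) :
    defectRestr A x = defectOp A (x : H₁) := rfl

theorem adjoint_defectMap (A : H₁ →L[ℂ] H₂) : (defectMap A).adjoint = defectRestr A := by
  ext x
  refine ext_inner_right ℂ fun y => ?_
  rw [ContinuousLinearMap.adjoint_inner_left, defectRestr_apply, inner_defectOp_left]
  rfl

theorem adjoint_defectRestr (A : H₁ →L[ℂ] H₂) : (defectRestr A).adjoint = defectMap A := by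
  rw [← adjoint_defectMap, ContinuousLinearMap.adjoint_adjoint]

theorem denseRange_defectMap (A : H₁ →L[ℂ] H₂) : DenseRange (defectMap A) := by
  rintro ⟨x, hx⟩
  rw [Metric.mem_closure_range_iff]
  intro ε hε
  obtain ⟨_, ⟨y, rfl⟩, hy⟩ := Metric.mem_closure_iff.1 hx ε hε
  exact ⟨y, hy⟩

/-- The kernel of a self-adjoint operator is orthogonal to the closure of its range. This allows
`D_A` to be cancelled on the left. -/
theorem eq_zero_of_defectOp_eq_zero {A : H₁ →L[ℂ] H₂} {x : H₁} (hx : x ∈ defectSpace A)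
    (h : defectOp A x = 0) : x = 0 := by
  have h1 : (⟨x, hx⟩ : defectSpace A) = 0 := by
    refine (denseRange_defectMap A).eq_zero_of_inner_left ℂ fun v => ?_
    change ⟪x, defectOp A v⟫_ℂ = 0
    rw [← inner_defectOp_left, h, inner_zero_left]
  exact congrArg Subtype.val h1

/-- Douglas factorization through the defect operator. -/
theorem exists_comp_defectMap_eq (A : H₁ →L[ℂ] H₂) (R : H₁ →L[ℂ] H) {C : ℝ}
    (hR : ∀ h, ‖R h‖ ≤ C * ‖defectOp A h‖) :
    ∃ W : defectSpace A →L[ℂ] H, W ∘L defectMap A = R := by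
  refine ⟨(R : H₁ →ₗ[ℂ] H).extendOfNorm (defectMap A : H₁ →ₗ[ℂ] defectSpace A), ?_⟩
  ext h
  exact LinearMap.extendOfNorm_eq (denseRange_defectMap A) ⟨C, hR⟩ h

theorem commute_defectOp {A : H₁ →L[ℂ] H₂} {S : H₁ →L[ℂ] H₁}
    (h : Commute S (A.adjoint ∘L A)) : Commute S (defectOp A) := by
  have h1 : Commute (1 - A.adjoint ∘L A) S := (Commute.one_left S).sub_left h.symm
  exact (h1.cfcₙ_nnreal _).symm

/-- With `k = l X D_A h`, the cross term of `‖A h + D_{A*} k‖²` is controlled by `‖D_{A*} A h‖ ≤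
‖D_A h‖`, so a small `k` costs no more than the available gap `‖h‖² - ‖A h‖² = ‖D_A h‖²`. -/
theorem ShmulyanDominated.exists_norm_add_smul_sub_le {A B : H₁ →L[ℂ] H₂} (hA : ‖A‖ ≤ 1)
    (h : ShmulyanDominated B A) :
    ∃ r : ℝ, 0 < r ∧ ∀ l : ℂ, ‖l‖ ≤ r → ‖A + l • (B - A)‖ ≤ 1 := by
  obtain ⟨X, rfl⟩ := h
  -- This radius forces `‖k‖ ≤ ‖D_A h‖ / 3`, and `2/3 + 1/9 ≤ 1`; the `+ 1` covers `X = 0`.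
  refine ⟨1 / (3 * (‖X‖ + 1)), by positivity, fun l hl => ?_⟩
  refine ContinuousLinearMap.opNorm_le_bound _ zero_le_one fun h => ?_
  rw [one_mul]
  set k : defectSpace A.adjoint := l • X (defectMap A h) with hk
  have h1 : (A + l • (A + defectRestr A.adjoint ∘L X ∘L defectMap A - A)) h =
      A h + defectOp A.adjoint k := by
    simp [hk]
  rw [h1]
  have hk1 : ‖k‖ ≤ 1 / 3 * ‖defectOp A h‖ := by
    rw [hk, norm_smul]
    have h2 : ‖X (defectMap A h)‖ ≤ (‖X‖ + 1) * ‖defectOp A h‖ :=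
      (X.le_opNorm _).trans (by rw [norm_defectMap]; gcongr; linarith)
    calc ‖l‖ * ‖X (defectMap A h)‖
        ≤ 1 / (3 * (‖X‖ + 1)) * ((‖X‖ + 1) * ‖defectOp A h‖) := by gcongr
      _ = 1 / 3 * ‖defectOp A h‖ := by
        have : ‖X‖ + 1 ≠ 0 := by positivity
        field_simp
  have h3 := norm_add_sq (𝕜 := ℂ) (A h) (defectOp A.adjoint k)
  have h4 : RCLike.re ⟪A h, defectOp A.adjoint k⟫_ℂ ≤ ‖defectOp A h‖ * ‖k‖ := by
    rw [← inner_defectOp_left]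
    refine (RCLike.re_le_norm _).trans ((norm_inner_le_norm _ _).trans ?_)
    exact mul_le_mul_of_nonneg_right (norm_defectOp_adjoint_apply_le hA h) (norm_nonneg _)
  have h5 : ‖defectOp A.adjoint k‖ ≤ ‖k‖ := norm_defectOp_le (norm_adjoint_le_one hA) _
  refine le_of_sq_le_sq ?_ (norm_nonneg _)
  have h6 := norm_defectOp_sq hA h
  have h7 := norm_nonneg k
  have h8 := norm_nonneg (defectOp A.adjoint k)
  have h9 := norm_nonneg (defectOp A h)
  have h10 : ‖defectOp A.adjoint k‖ ^ 2 ≤ (1 / 3 * ‖defectOp A h‖) ^ 2 :=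
    pow_le_pow_left₀ h8 (h5.trans hk1) 2
  nlinarith [mul_le_mul_of_nonneg_left hk1 h9]

end Defect

/-! ### From Shmul'yan equivalence to an analytic arc -/

section Arc

/-- If the discs of radius `r` around `A` and `B` on the complex line through `A` and `B` lie in the
unit ball, then so does their convex hull. -/
theorem norm_add_smul_sub_le_of_near_segment {E : Type*} [NormedAddCommGroup E] [NormedSpace ℂ E]
    {A B : E} {r : ℝ} (hA : ∀ l : ℂ, ‖l‖ ≤ r → ‖A + l • (B - A)‖ ≤ 1)
    (hB : ∀ l : ℂ, ‖l‖ ≤ r → ‖B + l • (A - B)‖ ≤ 1) {l : ℂ} {t : ℝ} (ht₀ : 0 ≤ t) (ht₁ : t ≤ 1)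
    (hl : ‖l - t‖ ≤ r) : ‖A + l • (B - A)‖ ≤ 1 := by
  have h1 : A + l • (B - A) = ((1 - t : ℝ) : ℂ) • (A + (l - t) • (B - A)) +
      (t : ℂ) • (B + (-(l - t)) • (A - B)) := by
    push_cast
    module
  have h2 := hA _ hl
  have h3 := hB (-(l - t)) (by rwa [norm_neg])
  rw [h1]
  refine (norm_add_le _ _).trans ?_
  rw [norm_smul, norm_smul, Complex.norm_real, Complex.norm_real, Real.norm_of_nonneg ht₀,
    Real.norm_of_nonneg (by linarith)]
  nlinarith

/-- An analytic map of the disc into a prescribed neighbourhood of the segment `[0, 1]`, fixing the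
origin and attaining `1`. -/
theorem exists_analytic_disc_near_segment {r : ℝ} (hr : 0 < r) :
    ∃ z₀ ∈ Metric.ball (0 : ℂ) 1, ∃ φ : ℂ → ℂ, AnalyticOnNhd ℂ φ (Metric.ball 0 1) ∧
      φ 0 = 0 ∧ φ z₀ = 1 ∧
      ∀ z ∈ Metric.ball (0 : ℂ) 1, ∃ t : ℝ, 0 ≤ t ∧ t ≤ 1 ∧ ‖φ z - t‖ ≤ r := by
  -- The map is `-ε log u` with `u = 1 - (1 - b) z`, which sends the disc into a thin horizontal
  -- strip. Since `|arg u| ≤ π / 2`, the height is at most `2 ε = r / 2`; `b < Re u` bounds the real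
  -- part above by `1 + r / 2`, and `‖u‖ ≤ 2` bounds it below by `-ε`. The value `1` is taken where
  -- `u = a`.
  set ε : ℝ := r / 4 with hε
  have hε0 : 0 < ε := by positivity
  set a : ℝ := Real.exp (-(1 / ε)) with ha
  set b : ℝ := Real.exp (-((1 + r / 2) / ε)) with hb
  have ha0 : 0 < a := Real.exp_pos _
  have hb0 : 0 < b := Real.exp_pos _
  have hab : b < a := by
    refine Real.exp_lt_exp.2 (neg_lt_neg ?_)
    gcongr
    linarith
  have ha1 : a < 1 := by
    rw [ha, Real.exp_lt_one_iff]
    exact neg_neg_of_pos (by positivity)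
  have hb1 : 0 < 1 - b := by linarith
  have hre : ∀ z ∈ Metric.ball (0 : ℂ) 1, b < (1 - (1 - b : ℝ) * z).re := by
    intro z hz
    have h1 : z.re < 1 := (Complex.re_le_norm z).trans_lt (mem_ball_zero_iff.1 hz)
    rw [Complex.sub_re, Complex.one_re, Complex.re_ofReal_mul]
    nlinarith
  refine ⟨((1 - a) / (1 - b) : ℝ), ?_, fun z => -ε * Complex.log (1 - (1 - b : ℝ) * z), ?_, ?_, ?_,
    ?_⟩
  · rw [mem_ball_zero_iff, Complex.norm_real, Real.norm_of_nonneg (by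
      apply div_nonneg <;> linarith), div_lt_one hb1]
    linarith
  · intro z hz
    refine analyticAt_const.mul (AnalyticAt.clog (by fun_prop) ?_)
    exact Or.inl (hb0.trans (hre z hz))
  · simp
  · have h1 : (1 : ℂ) - (1 - b : ℝ) * ((1 - a) / (1 - b) : ℝ) = (a : ℂ) := by
      rw [← Complex.ofReal_mul, mul_div_cancel₀ _ hb1.ne']
      push_cast
      ring
    beta_reduce
    rw [h1, ← Complex.ofReal_log ha0.le, ha, Real.log_exp]
    have : (ε : ℂ) ≠ 0 := by exact_mod_cast hε0.ne'
    push_cast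
    field_simp
  · intro z hz
    set u : ℂ := 1 - (1 - b : ℝ) * z with hu
    have hub : b < ‖u‖ := (hre z hz).trans_le (Complex.re_le_norm _)
    have hu2 : ‖u‖ ≤ 2 := by
      refine (norm_sub_le _ _).trans ?_
      rw [norm_one, norm_mul, Complex.norm_real, Real.norm_of_nonneg hb1.le]
      have := mem_ball_zero_iff.1 hz
      nlinarith [norm_nonneg z]
    set L := Complex.log u with hL
    have hLre : L.re = Real.log ‖u‖ := Complex.log_re _
    have hlow : -((1 + r / 2) / ε) ≤ L.re := by
      rw [hLre, ← Real.log_exp (-((1 + r / 2) / ε))]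
      exact Real.log_le_log hb0 hub.le
    have hup : L.re ≤ 1 := by
      rw [hLre]
      have := Real.log_le_sub_one_of_pos (hb0.trans hub)
      linarith
    have him : |L.im| ≤ 2 := by
      have h1 : |L.im| ≤ Real.pi / 2 := by
        rw [hL, Complex.log_im, Complex.abs_arg_le_pi_div_two_iff]
        exact (hb0.trans (hre z hz)).le
      linarith [Real.pi_lt_four]
    have hx1 : -(r / 4) ≤ -ε * L.re := by nlinarith
    have hx2 : -ε * L.re ≤ 1 + r / 2 := by
      have := mul_le_mul_of_nonneg_left hlow hε0.le
      have h3 : ε * -((1 + r / 2) / ε) = -(1 + r / 2) := by field_simp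
      linarith
    have hy : |-ε * L.im| ≤ r / 2 := by
      rw [abs_mul, abs_neg, abs_of_pos hε0]
      nlinarith
    have hφre : (-ε * L : ℂ).re = -ε * L.re := by
      rw [← Complex.ofReal_neg, Complex.re_ofReal_mul]
    have hφim : (-ε * L : ℂ).im = -ε * L.im := by
      rw [← Complex.ofReal_neg, Complex.im_ofReal_mul]
    -- The comparison point of the segment is the real part clamped to `[0, 1]`.
    refine ⟨max 0 (min 1 (-ε * L.re)), le_max_left _ _,
      max_le zero_le_one (min_le_left _ _), ?_⟩
    refine (Complex.norm_le_abs_re_add_abs_im _).trans ?_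
    rw [Complex.sub_re, Complex.sub_im, Complex.ofReal_re, Complex.ofReal_im, hφre, hφim, sub_zero]
    have hx : |-ε * L.re - max 0 (min 1 (-ε * L.re))| ≤ r / 2 := by
      rw [abs_le]
      constructor
      · rcases max_cases 0 (min 1 (-ε * L.re)) with h | h <;>
        rcases min_cases 1 (-ε * L.re) with h' | h' <;> linarith
      · rcases max_cases 0 (min 1 (-ε * L.re)) with h | h <;>
        rcases min_cases 1 (-ε * L.re) with h' | h' <;> linarith
    linarith

theorem ShmulyanEquivalent.exists_analytic_arc {H₁ H₂ : Type*}
    [NormedAddCommGroup H₁] [InnerProductSpace ℂ H₁] [CompleteSpace H₁]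
    [NormedAddCommGroup H₂] [InnerProductSpace ℂ H₂] [CompleteSpace H₂]
    {A B : H₁ →L[ℂ] H₂} (hA : ‖A‖ ≤ 1) (hB : ‖B‖ ≤ 1) (h : ShmulyanEquivalent A B) :
    ∃ z₀ ∈ Metric.ball (0 : ℂ) 1, ∃ F : ℂ → H₁ →L[ℂ] H₂,
      AnalyticOnNhd ℂ F (Metric.ball 0 1) ∧ (∀ z ∈ Metric.ball (0 : ℂ) 1, ‖F z‖ ≤ 1) ∧
        F 0 = A ∧ F z₀ = B := by
  obtain ⟨r₁, hr₁, h₁⟩ := h.2.exists_norm_add_smul_sub_le hA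
  obtain ⟨r₂, hr₂, h₂⟩ := h.1.exists_norm_add_smul_sub_le hB
  obtain ⟨z₀, hz₀, φ, hφ, hφ0, hφ1, hφt⟩ := exists_analytic_disc_near_segment (lt_min hr₁ hr₂)
  refine ⟨z₀, hz₀, fun z => A + φ z • (B - A), ?_, ?_, by simp [hφ0], by simp [hφ1]⟩
  · intro z hz
    exact analyticAt_const.add ((hφ z hz).smul analyticAt_const)
  · intro z hz
    obtain ⟨t, ht0, ht1, ht⟩ := hφt z hz
    exact norm_add_smul_sub_le_of_near_segment
      (fun l hl => h₁ l (hl.trans (min_le_left _ _)))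
      (fun l hl => h₂ l (hl.trans (min_le_right _ _))) ht0 ht1 ht

end Arc

/-! ### From the shift intertwining to Shmul'yan equivalence -/

section Shmulyan

variable {H : Type*} [NormedAddCommGroup H] [InnerProductSpace ℂ H] [CompleteSpace H]

/-- If `y ≤ x`, then `y² ≤ x y` and one factor `x` cancels. It closes the comparisons of defect
norms, where the quantity to be bounded also occurs in the cross term. -/
theorem le_of_sq_le_sq_add {x y z : ℝ} (hy : 0 ≤ y) (hz : 0 ≤ z)
    (h : x ^ 2 ≤ y ^ 2 + 2 * (z * x * y)) : x ≤ (1 + 2 * z) * y := by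
  by_contra! hc
  have h1 : y ≤ x := by nlinarith [mul_nonneg hz hy]
  nlinarith [mul_nonneg hz hy, mul_le_mul_of_nonneg_left h1 hy, mul_nonneg (hy.trans h1) hy]

section Factorization

variable {H₁ H₂ H₃ H₄ : Type*}
  [NormedAddCommGroup H₁] [InnerProductSpace ℂ H₁] [CompleteSpace H₁]
  [NormedAddCommGroup H₂] [InnerProductSpace ℂ H₂] [CompleteSpace H₂]
  [NormedAddCommGroup H₃] [InnerProductSpace ℂ H₃] [CompleteSpace H₃]
  [NormedAddCommGroup H₄] [InnerProductSpace ℂ H₄] [CompleteSpace H₄]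

/-- The dual Douglas factorization, with the self-adjoint defect operator on the left: factor `R*`
and take adjoints. -/
theorem exists_defectRestr_comp_eq (A : H₁ →L[ℂ] H₂) (R : H₃ →L[ℂ] H₁) {C : ℝ}
    (hR : ∀ h, ‖R.adjoint h‖ ≤ C * ‖defectOp A h‖) :
    ∃ W : H₃ →L[ℂ] defectSpace A, defectRestr A ∘L W = R := by
  obtain ⟨W, hW⟩ := exists_comp_defectMap_eq A R.adjoint hR
  refine ⟨W.adjoint, ?_⟩
  rw [← adjoint_defectMap, ← ContinuousLinearMap.adjoint_comp, hW,
    ContinuousLinearMap.adjoint_adjoint]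

theorem adjoint_defectRestr_comp_comp (A : H₁ →L[ℂ] H₂) (A' : H₃ →L[ℂ] H₄)
    (Z : defectSpace A' →L[ℂ] defectSpace A) :
    (defectRestr A ∘L Z ∘L defectMap A').adjoint = defectRestr A' ∘L Z.adjoint ∘L defectMap A := by
  rw [ContinuousLinearMap.adjoint_comp, ContinuousLinearMap.adjoint_comp, adjoint_defectMap,
    adjoint_defectRestr, ContinuousLinearMap.comp_assoc]

end Factorization

/-- If `T - T' = D_{T*} Z D_{T'}` for contractions, then `‖D_{T*} h‖ ≤ C ‖D_{T'*} h‖`, so the left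
factor may be replaced by `D_{T'*}`. -/
theorem shmulyanDominated_of_sub_eq {H₁ H₂ : Type*}
    [NormedAddCommGroup H₁] [InnerProductSpace ℂ H₁] [CompleteSpace H₁]
    [NormedAddCommGroup H₂] [InnerProductSpace ℂ H₂] [CompleteSpace H₂]
    {T T' : H₁ →L[ℂ] H₂} (hT : ‖T‖ ≤ 1) (hT' : ‖T'‖ ≤ 1)
    (Z : defectSpace T' →L[ℂ] defectSpace T.adjoint)
    (hZ : T - T' = defectRestr T.adjoint ∘L Z ∘L defectMap T') : ShmulyanDominated T T' := by
  have hadj : T.adjoint = T'.adjoint + (defectRestr T' ∘L Z.adjoint ∘L defectMap T.adjoint) := by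
    rw [← adjoint_defectRestr_comp_comp, ← hZ, map_sub, add_sub_cancel]
  have hle : ∀ h, ‖defectMap T.adjoint h‖ ≤ (1 + 2 * ‖Z‖) * ‖defectOp T'.adjoint h‖ := by
    intro h
    -- Expanding `‖T* h‖² = ‖T'* h + D_{T'} k‖²` and subtracting from `‖h‖²` compares the squared
    -- defect norms; only the cross term must be estimated.
    refine le_of_sq_le_sq_add (norm_nonneg _) Z.opNorm_nonneg ?_
    set k := Z.adjoint (defectMap T.adjoint h) with hk
    have hkn : ‖k‖ ≤ ‖Z‖ * ‖defectOp T.adjoint h‖ := by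
      have := Z.adjoint.le_opNorm (defectMap T.adjoint h)
      rwa [LinearIsometryEquiv.norm_map] at this
    have h1 : T.adjoint h = T'.adjoint h + defectOp T' k := by
      conv_lhs => rw [hadj]
      simp [hk]
    have h2 := norm_add_sq (𝕜 := ℂ) (T'.adjoint h) (defectOp T' k)
    rw [← h1, ← inner_defectOp_left] at h2
    have h3 : -RCLike.re ⟪defectOp T' (T'.adjoint h), (k : H₁)⟫_ℂ ≤
        ‖defectOp T'.adjoint h‖ * (‖Z‖ * ‖defectOp T.adjoint h‖) := by
      refine (neg_le_abs _).trans ((RCLike.abs_re_le_norm _).trans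
        ((norm_inner_le_norm _ _).trans ?_))
      exact mul_le_mul (norm_adjoint_defectOp_apply_le hT' h) hkn (norm_nonneg _) (norm_nonneg _)
    rw [norm_defectMap, norm_defectOp_sq (norm_adjoint_le_one hT),
      norm_defectOp_sq (norm_adjoint_le_one hT')]
    nlinarith [sq_nonneg ‖defectOp T' k‖]
  obtain ⟨W, hW⟩ := exists_defectRestr_comp_eq T'.adjoint (defectRestr T.adjoint)
    (by rwa [adjoint_defectRestr T.adjoint])
  refine ⟨W ∘L Z, ?_⟩
  refine (eq_add_of_sub_eq' hZ).trans ?_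
  rw [← hW]
  rfl

/-- If `T - T' = D_{T*} Z D_{T'}` for contractions, then `‖D_{T'} h‖ ≤ C ‖D_T h‖`, so the right
factor may be replaced by `D_T`. -/
theorem shmulyanDominated_symm_of_sub_eq {H₁ H₂ : Type*}
    [NormedAddCommGroup H₁] [InnerProductSpace ℂ H₁] [CompleteSpace H₁]
    [NormedAddCommGroup H₂] [InnerProductSpace ℂ H₂] [CompleteSpace H₂]
    {T T' : H₁ →L[ℂ] H₂} (hT : ‖T‖ ≤ 1) (hT' : ‖T'‖ ≤ 1)
    (Z : defectSpace T' →L[ℂ] defectSpace T.adjoint)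
    (hZ : T - T' = defectRestr T.adjoint ∘L Z ∘L defectMap T') : ShmulyanDominated T' T := by
  have hle : ∀ h, ‖defectMap T' h‖ ≤ (1 + 2 * ‖Z‖) * ‖defectOp T h‖ := by
    intro h
    refine le_of_sq_le_sq_add (norm_nonneg _) Z.opNorm_nonneg ?_
    set k := Z (defectMap T' h) with hk
    have hkn : ‖k‖ ≤ ‖Z‖ * ‖defectOp T' h‖ := Z.le_opNorm (defectMap T' h)
    have h1 : T' h = T h - defectOp T.adjoint k := by
      rw [eq_sub_iff_add_eq', eq_comm, ← sub_eq_iff_eq_add, ← sub_apply, hZ]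
      rfl
    have h2 := norm_sub_sq (𝕜 := ℂ) (T h) (defectOp T.adjoint k)
    rw [← h1, ← inner_defectOp_left] at h2
    have h3 : RCLike.re ⟪defectOp T.adjoint (T h), (k : H₂)⟫_ℂ ≤
        ‖defectOp T h‖ * (‖Z‖ * ‖defectOp T' h‖) := by
      refine (RCLike.re_le_norm _).trans ((norm_inner_le_norm _ _).trans ?_)
      exact mul_le_mul (norm_defectOp_adjoint_apply_le hT h) hkn (norm_nonneg _) (norm_nonneg _)
    rw [norm_defectMap, norm_defectOp_sq hT, norm_defectOp_sq hT']
    nlinarith [sq_nonneg ‖defectOp T.adjoint k‖]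
  obtain ⟨W, hW⟩ := exists_comp_defectMap_eq T (defectMap T') hle
  refine ⟨-(Z ∘L W), ?_⟩
  have hT'eq : T' = T - defectRestr T.adjoint ∘L Z ∘L defectMap T' :=
    eq_sub_of_add_eq (eq_add_of_sub_eq' hZ).symm
  refine hT'eq.trans ?_
  rw [← hW]
  ext x
  simp [sub_eq_add_neg]

/-- If `T - T' = D_{T*} Z D_{T'}` for contractions `T`, `T'`, then `T` and `T'` are Shmul'yan
equivalent. -/
theorem shmulyanEquivalent_of_sub_eq {H₁ H₂ : Type*}
    [NormedAddCommGroup H₁] [InnerProductSpace ℂ H₁] [CompleteSpace H₁]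
    [NormedAddCommGroup H₂] [InnerProductSpace ℂ H₂] [CompleteSpace H₂]
    {T T' : H₁ →L[ℂ] H₂} (hT : ‖T‖ ≤ 1) (hT' : ‖T'‖ ≤ 1)
    (Z : defectSpace T' →L[ℂ] defectSpace T.adjoint)
    (hZ : T - T' = defectRestr T.adjoint ∘L Z ∘L defectMap T') : ShmulyanEquivalent T T' :=
  ⟨shmulyanDominated_of_sub_eq hT hT' Z hZ, shmulyanDominated_symm_of_sub_eq hT hT' Z hZ⟩

theorem shift_apply_zero {E : Type*} [NormedAddCommGroup E] [InnerProductSpace ℂ E]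
    (f : SeqSpace E) : shift E f 0 = 0 := rfl

theorem shift_apply_succ {E : Type*} [NormedAddCommGroup E] [InnerProductSpace ℂ E]
    (f : SeqSpace E) (n : ℕ) : shift E f (n + 1) = f n := rfl

theorem shift_single {E : Type*} [NormedAddCommGroup E] [InnerProductSpace ℂ E] (n : ℕ) (x : E) :
    shift E (lp.single 2 n x) = lp.single 2 (n + 1) x := by
  ext m
  cases m with
  | zero => simp [shift_apply_zero]
  | succ m => simp [shift_apply_succ, Pi.single_apply]

/-- The coordinates of the adjoint of an operator intertwining the shift and `T`. -/
theorem adjoint_apply_of_comp_shift_eq {E : Type*} [NormedAddCommGroup E] [InnerProductSpace ℂ E]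
    [CompleteSpace E] {T : H →L[ℂ] H} {B : SeqSpace E →L[ℂ] H} (hB : B ∘L shift E = T ∘L B)
    (h : H) (n : ℕ) :
    B.adjoint h n = (B ∘L inclZero E).adjoint ((T.adjoint ^ n) h) := by
  have h1 : ∀ n x, B (lp.single 2 n x) = (T ^ n) (B (inclZero E x)) := by
    intro n x
    induction n with
    | zero => rfl
    | succ n ih =>
      rw [← shift_single, ← ContinuousLinearMap.comp_apply, hB, ContinuousLinearMap.comp_apply, ih,
        pow_succ']
      rfl
  refine ext_inner_left ℂ fun x => ?_
  refine (lp.inner_single_left (𝕜 := ℂ) n x (B.adjoint h)).symm.trans ?_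
  rw [ContinuousLinearMap.adjoint_inner_right, h1,
    ContinuousLinearMap.adjoint_inner_right, ← ContinuousLinearMap.star_eq_adjoint, ← star_pow,
    ContinuousLinearMap.star_eq_adjoint, ContinuousLinearMap.adjoint_inner_right]
  rfl

theorem sum_norm_sq_adjoint_le_of_comp_shift_eq {E : Type*} [NormedAddCommGroup E]
    [InnerProductSpace ℂ E] [CompleteSpace E] {T : H →L[ℂ] H} {B : SeqSpace E →L[ℂ] H}
    (hB : B ∘L shift E = T ∘L B) (h : H) (N : ℕ) :
    ∑ n ∈ Finset.range N, ‖(B ∘L inclZero E).adjoint ((T.adjoint ^ n) h)‖ ^ 2 ≤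
      (‖B‖ * ‖h‖) ^ 2 := by
  have h1 := lp.sum_rpow_le_norm_rpow (p := 2) (by norm_num) (B.adjoint h) (Finset.range N)
  simp only [ENNReal.toReal_ofNat, Real.rpow_ofNat] at h1
  simp only [adjoint_apply_of_comp_shift_eq hB] at h1
  refine h1.trans (pow_le_pow_left₀ (norm_nonneg _) ?_ 2)
  simpa using B.adjoint.le_opNorm h

/-- The bound `‖B₀* h‖ ≤ ‖B‖ ‖D_{T*} h‖` is the crux: it extracts a factor `D_{T*}` from `B₀`,
giving `T - T'` the mixed form `D_{T*} Z D_{T'}`. -/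
theorem shmulyanEquivalent_of_shift_intertwining {T T' : H →L[ℂ] H} (hT : ‖T‖ ≤ 1) (hT' : ‖T'‖ ≤ 1)
    (hqn : IsQuasiNormal T.adjoint) (hTT' : Commute T T')
    (hTT'T' : Commute T (T'.adjoint * T')) (hT'TT : Commute T' (T * T.adjoint))
    {B : SeqSpace (defectSpace T') →L[ℂ] H}
    (hTB : T = T' + B ∘L inclZero (defectSpace T') ∘L defectMap T')
    (hB : B ∘L shift (defectSpace T') = T ∘L B) : ShmulyanEquivalent T T' := by
  set d := defectOp T.adjoint with hd
  set D := defectOp T' with hD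
  set B₀ := B ∘L inclZero (defectSpace T') with hB₀
  set E : H →L[ℂ] H := (defectSpace T').subtypeL ∘L B₀.adjoint with hE
  have hsa : ∀ {S R : H →L[ℂ] H}, IsSelfAdjoint R → Commute S R → Commute S.adjoint R := by
    intro S R hR h
    have := h.star_star
    rwa [hR.star_eq] at this
  have hP : T.adjoint.adjoint ∘L T.adjoint = T * T.adjoint := by
    rw [ContinuousLinearMap.adjoint_adjoint]; rfl
  have hdT : Commute T.adjoint d := commute_defectOp hqn
  have hdT' : Commute T' d := commute_defectOp (by rwa [hP])
  have hdT'' : Commute T'.adjoint d := hsa (isSelfAdjoint_defectOp _) hdT'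
  have hDT : Commute T D := commute_defectOp hTT'T'
  have hDT' : Commute T.adjoint D := hsa (isSelfAdjoint_defectOp _) hDT
  have hdD : Commute d D := commute_defectOp (hdT''.symm.mul_right hdT'.symm)
  have hTadj : T.adjoint = T'.adjoint + D * E := by
    have h1 : T = T' + B₀ ∘L defectMap T' := hTB
    have := congrArg ContinuousLinearMap.adjoint h1
    rw [map_add, ContinuousLinearMap.adjoint_comp, adjoint_defectMap] at this
    exact this
  have hDE : D * E = T.adjoint - T'.adjoint := by rw [hTadj, add_sub_cancel_left]
  -- `D (S E - E S) = 0` follows from `D E = T* - T'*`. The range of `S E - E S` lies in the defect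
  -- space of `T'`, where `D` is injective.
  have hEcomm : ∀ S : H →L[ℂ] H, Commute S D → Commute S (T.adjoint - T'.adjoint) →
      Commute S E := by
    intro S hSD hS
    ext h
    refine sub_eq_zero.1 (eq_zero_of_defectOp_eq_zero (A := T') (Submodule.sub_mem _ ?_ ?_) ?_)
    · have hmap : Set.MapsTo S (Set.range D) (Set.range D) := by
        rintro _ ⟨y, rfl⟩
        exact ⟨S y, (congrArg (fun R : H →L[ℂ] H => R y) hSD.eq).symm⟩
      exact hmap.closure S.continuous (B₀.adjoint h).2
    · exact (B₀.adjoint (S h)).2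
    · have h1 : D * (S * E - E * S) = 0 := by
        rw [mul_sub, ← mul_assoc, ← hSD.eq, mul_assoc, hDE, ← mul_assoc, hDE, hS.eq, sub_self]
      exact congrArg (fun R : H →L[ℂ] H => R h) h1
  have hTE : Commute T.adjoint E :=
    hEcomm _ hDT' ((Commute.refl _).sub_right hTT'.star_star)
  have hdE : Commute d E := hEcomm _ hdD (hdT.symm.sub_right hdT''.symm)
  have hsum : ∀ h N, ∑ n ∈ Finset.range N, ‖(T.adjoint ^ n) (E h)‖ ^ 2 ≤ (‖B‖ * ‖h‖) ^ 2 := by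
    intro h N
    refine le_of_eq_of_le (Finset.sum_congr rfl fun n _ => ?_)
      (sum_norm_sq_adjoint_le_of_comp_shift_eq hB h N)
    have : (T.adjoint ^ n) (E h) = E ((T.adjoint ^ n) h) :=
      congrArg (fun R : H →L[ℂ] H => R h) (hTE.pow_left n).eq
    rw [this]
    rfl
  have hlim : ∀ h, Filter.Tendsto (fun n => ‖(T.adjoint ^ n) (E h)‖ ^ 2) Filter.atTop (nhds 0) :=
    fun h => (summable_of_sum_range_le (fun _ => sq_nonneg _) (hsum h)).tendsto_atTop_zero
  -- Move `d` to the front and use `‖d y‖² = ‖y‖² - ‖T* y‖²`. The remainder tends to zero, being the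
  -- general term of a convergent series.
  have htel : ∀ h N, ∑ n ∈ Finset.range N, ‖(T.adjoint ^ n) (E (d h))‖ ^ 2 =
      ‖E h‖ ^ 2 - ‖(T.adjoint ^ N) (E h)‖ ^ 2 := by
    intro h N
    have h1 : ∀ n, ‖(T.adjoint ^ n) (E (d h))‖ ^ 2 =
        ‖(T.adjoint ^ n) (E h)‖ ^ 2 - ‖(T.adjoint ^ (n + 1)) (E h)‖ ^ 2 := by
      intro n
      have h2 : (T.adjoint ^ n) (E (d h)) = d ((T.adjoint ^ n) (E h)) := by
        have : (T.adjoint ^ n) * (E * d) = d * ((T.adjoint ^ n) * E) := by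
          rw [← hdE.eq, ← mul_assoc, (hdT.pow_left n).eq, mul_assoc]
        exact congrArg (fun R : H →L[ℂ] H => R h) this
      rw [h2, norm_defectOp_sq (norm_adjoint_le_one hT), pow_succ' T.adjoint]
      rfl
    rw [Finset.sum_congr rfl fun n _ => h1 n, Finset.sum_range_sub']
    simp
  have hbound : ∀ h, ‖B₀.adjoint h‖ ≤ ‖B‖ * ‖d h‖ := by
    intro h
    refine le_of_sq_le_sq ?_ (by positivity)
    have h1 : Filter.Tendsto (fun N => ‖E h‖ ^ 2 - ‖(T.adjoint ^ N) (E h)‖ ^ 2) Filter.atTop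
        (nhds (‖E h‖ ^ 2 - 0)) := tendsto_const_nhds.sub (hlim h)
    rw [sub_zero] at h1
    exact le_of_tendsto' h1 fun N => (htel h N).symm.trans_le (hsum (d h) N)
  obtain ⟨Z, hZ⟩ := exists_defectRestr_comp_eq T.adjoint B₀ hbound
  refine shmulyanEquivalent_of_sub_eq hT hT' Z ?_
  rw [← ContinuousLinearMap.comp_assoc, hZ, sub_eq_iff_eq_add']
  exact hTB

end Shmulyan

/-! ### Discrete Fourier averages and Fejér means -/

section RootsOfUnity

open Finset

theorem re_natCast_mul (n : ℕ) (z : ℂ) : ((n : ℂ) * z).re = n * z.re := by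
  rw [← Complex.ofReal_natCast, Complex.re_ofReal_mul]

theorem sum_pow_mul_conj_pow {M : ℕ} {ζ : ℂ} (hζ : IsPrimitiveRoot ζ M) (k l : ℕ)
    (hk : k < M) (hl : l < M) :
    ∑ j ∈ range M, (ζ ^ j) ^ k * (starRingEnd ℂ (ζ ^ j)) ^ l = if k = l then (M : ℂ) else 0 := by
  have hM : M ≠ 0 := by omega
  have hζ0 : ζ ≠ 0 := hζ.ne_zero hM
  have hconj : starRingEnd ℂ ζ = ζ⁻¹ :=
    (Complex.inv_eq_conj (Complex.norm_eq_one_of_pow_eq_one hζ.pow_eq_one hM)).symm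
  have h1 : ∀ j, (ζ ^ j) ^ k * (starRingEnd ℂ (ζ ^ j)) ^ l = (ζ ^ ((k : ℤ) - l)) ^ j := by
    intro j
    rw [map_pow, hconj, zpow_sub₀ hζ0, zpow_natCast, zpow_natCast, div_eq_mul_inv, mul_pow,
      ← pow_mul, ← pow_mul, inv_pow, inv_pow, ← pow_mul, ← pow_mul, mul_comm j k, mul_comm j l]
  rw [sum_congr rfl fun j _ => h1 j]
  split_ifs with hkl
  · simp [hkl]
  · have hne : ζ ^ ((k : ℤ) - l) ≠ 1 := by
      rw [Ne, hζ.zpow_eq_one_iff_dvd]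
      intro hdvd
      have := Int.eq_zero_of_abs_lt_dvd hdvd (by rw [abs_lt]; omega)
      omega
    have hpow : (ζ ^ ((k : ℤ) - l)) ^ M = 1 := by
      rw [← zpow_natCast, ← zpow_mul, mul_comm, zpow_mul, zpow_natCast, hζ.pow_eq_one, one_zpow]
    rw [geom_sum_eq hne, hpow, sub_self, zero_div]

theorem sum_eval_mul_eval_conj {M R : ℕ} {ζ : ℂ} (hζ : IsPrimitiveRoot ζ M) (hR : R ≤ M)
    (a b : ℕ → ℂ) :
    ∑ j ∈ range M, (∑ k ∈ range R, a k * (ζ ^ j) ^ k) *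
      (∑ l ∈ range R, b l * (starRingEnd ℂ (ζ ^ j)) ^ l) = M * ∑ k ∈ range R, a k * b k := by
  simp_rw [sum_mul_sum]
  rw [sum_comm, mul_sum]
  refine sum_congr rfl fun k hk => ?_
  rw [sum_comm]
  have hk' := mem_range.1 hk
  have : ∀ l ∈ range R, ∑ j ∈ range M, a k * (ζ ^ j) ^ k * (b l * (starRingEnd ℂ (ζ ^ j)) ^ l) =
      if k = l then M * (a k * b l) else 0 := by
    intro l hl
    have hl' := mem_range.1 hl
    have h1 := sum_pow_mul_conj_pow hζ k l (by omega) (by omega)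
    calc _ = a k * b l * ∑ j ∈ range M, (ζ ^ j) ^ k * (starRingEnd ℂ (ζ ^ j)) ^ l := by
          rw [mul_sum]
          exact sum_congr rfl fun j _ => by ring
      _ = _ := by
          rw [h1]
          split_ifs <;> ring
  rw [sum_congr rfl this, sum_ite_eq, if_pos hk]

/-- The exponents `k + l` stay below `M`, so no nonconstant term aliases to the constant one. -/
theorem sum_eval_mul_eval {M R : ℕ} {ζ : ℂ} (hζ : IsPrimitiveRoot ζ M) (hR : 2 * R ≤ M)
    (hR0 : 0 < R) (a b : ℕ → ℂ) :
    ∑ j ∈ range M, (∑ k ∈ range R, a k * (ζ ^ j) ^ k) * (∑ l ∈ range R, b l * (ζ ^ j) ^ l) =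
      M * (a 0 * b 0) := by
  simp_rw [sum_mul_sum]
  rw [sum_comm]
  have : ∀ k ∈ range R, ∑ j ∈ range M, ∑ l ∈ range R, a k * (ζ ^ j) ^ k * (b l * (ζ ^ j) ^ l) =
      if k = 0 then M * (a 0 * b 0) else 0 := by
    intro k hk
    have hk' := mem_range.1 hk
    rw [sum_comm]
    have h2 : ∀ l ∈ range R, ∑ j ∈ range M, a k * (ζ ^ j) ^ k * (b l * (ζ ^ j) ^ l) =
        if l = 0 then (if k = 0 then M * (a 0 * b 0) else 0) else 0 := by
      intro l hl
      have hl' := mem_range.1 hl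
      have h1 := sum_pow_mul_conj_pow hζ (k + l) 0 (by omega) (by omega)
      calc _ = a k * b l * ∑ j ∈ range M, (ζ ^ j) ^ (k + l) * (starRingEnd ℂ (ζ ^ j)) ^ 0 := by
            rw [mul_sum]
            exact sum_congr rfl fun j _ => by ring
        _ = _ := by
            rw [h1]
            by_cases hl0 : l = 0 <;> by_cases hk0 : k = 0 <;> simp [hl0, hk0]; ring
    rw [sum_congr rfl h2, sum_ite_eq', if_pos (mem_range.2 hR0)]
  rw [sum_congr rfl this, sum_ite_eq', if_pos (mem_range.2 hR0)]

/-- Nonnegativity of all Fejér means of a finitely supported sequence implies nonnegativity of its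
sum. -/
theorem sum_nonneg_of_fejer_nonneg {x : ℕ → ℝ} {N : ℕ} (hx : ∀ k, N ≤ k → x k = 0)
    (h : ∀ L : ℕ, 0 ≤ ∑ k ∈ range L, ((L - k : ℕ) : ℝ) * x k) : 0 ≤ ∑ k ∈ range N, x k := by
  by_contra! hneg
  -- For `L ≥ N` the Fejér sum is `L ∑ x k - ∑ k x k`; past this ratio a negative `∑ x k` would make
  -- it negative.
  obtain ⟨L₀, hL₀⟩ := exists_nat_gt
    ((-∑ k ∈ range N, (k : ℝ) * x k) / (-∑ k ∈ range N, x k))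
  set L := max L₀ N with hL
  have h1 : ∑ k ∈ range L, ((L - k : ℕ) : ℝ) * x k =
      L * ∑ k ∈ range N, x k - ∑ k ∈ range N, (k : ℝ) * x k := by
    rw [← sum_subset (range_subset_range.2 (le_max_right L₀ N)), mul_sum, ← sum_sub_distrib]
    · refine sum_congr rfl fun k hk => ?_
      rw [Nat.cast_sub ((mem_range.1 hk).le.trans (le_max_right _ _)), sub_mul]
    · intro k _ hk
      rw [hx k (not_lt.1 fun hlt => hk (mem_range.2 hlt)), mul_zero]
  have h2 := h L
  rw [h1] at h2
  rw [div_lt_iff₀ (neg_pos.2 hneg)] at hL₀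
  have h3 : (L₀ : ℝ) ≤ L := by exact_mod_cast le_max_left L₀ N
  nlinarith

end RootsOfUnity

/-! ### Fejér positivity and von Neumann's inequality -/

section Fejer

open Finset

/-- The weights `1, 2, 2, …` of the real part of a Fourier series. -/
def fourierWeight (k : ℕ) : ℝ := if k = 0 then 1 else 2

variable {H : Type*} [NormedAddCommGroup H] [InnerProductSpace ℂ H]

theorem sum_fourierWeight_inner (T : H →L[ℂ] H) (h : H) (N : ℕ) :
    (∑ k ∈ range (N + 1), fourierWeight k * ⟪h, (T ^ k) h⟫_ℂ).re =
      ‖h‖ ^ 2 + 2 * (⟪h, T (∑ k ∈ range N, (T ^ k) h)⟫_ℂ).re := by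
  rw [sum_range_succ', Complex.add_re, add_comm]
  congr 1
  · have := inner_self_eq_norm_sq (𝕜 := ℂ) h
    simpa [fourierWeight] using this
  · rw [map_sum, inner_sum, Complex.re_sum, Complex.re_sum, mul_sum]
    refine sum_congr rfl fun k _ => ?_
    rw [pow_succ', Complex.re_ofReal_mul]
    simp [fourierWeight]

/-- The Fejér sum dominates `‖S_N‖²`, where `S_N = ∑_{k<N} Tᵏ h`. In the induction `S_{N+1} = h + T
S_N`, and the increment of the Fejér sum is `‖h‖² + 2 Re ⟪h, T S_N⟫`, so `‖T S_N‖ ≤ ‖S_N‖` suffices.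
-/
theorem fejer_nonneg {T : H →L[ℂ] H} (hT : ‖T‖ ≤ 1) (h : H) (N : ℕ) :
    0 ≤ (∑ k ∈ range N, ((N - k : ℕ) : ℂ) * (fourierWeight k * ⟪h, (T ^ k) h⟫_ℂ)).re := by
  suffices hs : ‖∑ k ∈ range N, (T ^ k) h‖ ^ 2 ≤
      (∑ k ∈ range N, ((N - k : ℕ) : ℂ) * (fourierWeight k * ⟪h, (T ^ k) h⟫_ℂ)).re from
    (sq_nonneg _).trans hs
  induction N with
  | zero => simp
  | succ N ih =>
    have h1 : ∑ k ∈ range (N + 1), ((N + 1 - k : ℕ) : ℂ) * (fourierWeight k * ⟪h, (T ^ k) h⟫_ℂ) =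
        ∑ k ∈ range N, ((N - k : ℕ) : ℂ) * (fourierWeight k * ⟪h, (T ^ k) h⟫_ℂ) +
          ∑ k ∈ range (N + 1), fourierWeight k * ⟪h, (T ^ k) h⟫_ℂ := by
      have h2 : ∑ k ∈ range N, ((N - k : ℕ) : ℂ) * (fourierWeight k * ⟪h, (T ^ k) h⟫_ℂ) =
          ∑ k ∈ range (N + 1), ((N - k : ℕ) : ℂ) * (fourierWeight k * ⟪h, (T ^ k) h⟫_ℂ) := by
        rw [sum_range_succ]
        simp
      rw [h2, ← sum_add_distrib]
      refine sum_congr rfl fun k hk => ?_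
      rw [Nat.succ_sub (Nat.lt_succ_iff.1 (mem_range.1 hk))]
      push_cast
      ring
    rw [h1, Complex.add_re, sum_fourierWeight_inner]
    set S := ∑ k ∈ range N, (T ^ k) h with hS
    have h3 : ∑ k ∈ range (N + 1), (T ^ k) h = h + T S := by
      rw [sum_range_succ', hS, map_sum, add_comm]
      simp [pow_succ']
    have h4 := norm_add_sq (𝕜 := ℂ) h (T S)
    rw [RCLike.re_to_complex] at h4
    have h5 := pow_le_pow_left₀ (norm_nonneg _) (norm_apply_le_of_contraction hT S) 2
    rw [h3]
    linarith

/-- The Fejér polynomial whose real part at `z` is the Fejér kernel at `w z`. -/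
noncomputable def fejerPoly (N : ℕ) (w : ℂ) : Polynomial ℂ :=
  ∑ k ∈ range N, Polynomial.C (((N - k : ℕ) : ℂ) * (fourierWeight k * w ^ k)) * Polynomial.X ^ k

/-- The operator statement `fejer_nonneg` for multiplication by `w z` on `ℂ`. -/
theorem fejerPoly_eval_re_nonneg (N : ℕ) {w z : ℂ} (hw : ‖w‖ ≤ 1) (hz : ‖z‖ ≤ 1) :
    0 ≤ ((fejerPoly N w).eval z).re := by
  have hT : ‖(w * z) • ContinuousLinearMap.id ℂ ℂ‖ ≤ 1 := by
    refine ContinuousLinearMap.opNorm_le_bound _ zero_le_one fun x => ?_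
    simp only [smul_apply, ContinuousLinearMap.id_apply, norm_smul, norm_mul]
    exact mul_le_mul_of_nonneg_right (mul_le_one₀ hw (norm_nonneg _) hz) (norm_nonneg _)
  have h1 := fejer_nonneg hT 1 N
  have h2 : ∀ k, (((w * z) • ContinuousLinearMap.id ℂ ℂ) ^ k) 1 = (w * z) ^ k := by
    intro k
    induction k with
    | zero => simp
    | succ k ih =>
      rw [pow_succ', ContinuousLinearMap.mul_def, ContinuousLinearMap.comp_apply, ih, pow_succ']
      simp
  simp only [h2] at h1
  rw [fejerPoly, Polynomial.eval_finsetSum]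
  convert h1 using 3 with k hk
  simp [mul_pow]
  ring

theorem inner_aeval_fejerPoly (T : H →L[ℂ] H) (N : ℕ) (w : ℂ) (x y : H) :
    ⟪x, (Polynomial.aeval T (fejerPoly N w)) y⟫_ℂ =
      ∑ k ∈ range N, ((N - k : ℕ) : ℂ) * (fourierWeight k * (w ^ k * ⟪x, (T ^ k) y⟫_ℂ)) := by
  rw [fejerPoly, map_sum, _root_.sum_apply, inner_sum]
  refine sum_congr rfl fun k _ => ?_
  rw [map_mul, Polynomial.aeval_C, map_pow, Polynomial.aeval_X,
    ContinuousLinearMap.mul_def, ContinuousLinearMap.comp_apply,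
    ContinuousLinearMap.algebraMap_apply, inner_smul_right]
  ring

/-- A form of von Neumann's inequality: a polynomial with nonnegative real part on the closed unit
disc has nonnegative real part at every contraction. -/
theorem re_inner_aeval_nonneg {T : H →L[ℂ] H} (hT : ‖T‖ ≤ 1) {p : Polynomial ℂ}
    (hp : ∀ z : ℂ, ‖z‖ ≤ 1 → 0 ≤ (p.eval z).re) (h : H) :
    0 ≤ (⟪h, (Polynomial.aeval T p) h⟫_ℂ).re := by
  have haeval : (⟪h, (Polynomial.aeval T p) h⟫_ℂ).re =
      ∑ k ∈ range (p.natDegree + 1), (p.coeff k * ⟪h, (T ^ k) h⟫_ℂ).re := by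
    rw [Polynomial.aeval_eq_sum_range, _root_.sum_apply, inner_sum, Complex.re_sum]
    refine sum_congr rfl fun k _ => ?_
    rw [smul_apply, inner_smul_right]
  rw [haeval]
  refine sum_nonneg_of_fejer_nonneg (fun k hk => ?_) fun N => ?_
  · rw [Polynomial.coeff_eq_zero_of_natDegree_lt (by omega), zero_mul, Complex.zero_re]
  -- The `N`-th Fejér sum arises by averaging the product of the nonnegative numbers `Re p(ζʲ)` and
  -- the Fejér sum of the contraction `conj(ζʲ) T`. `R` exceeds both degrees, and `M = 2 R` excludes
  -- aliasing.
  set R := p.natDegree + 1 + N with hR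
  set M := 2 * R with hM
  have hM0 : M ≠ 0 := by omega
  set ζ := Complex.exp (2 * Real.pi * Complex.I / M) with hζdef
  have hζ : IsPrimitiveRoot ζ M := Complex.isPrimitiveRoot_exp M hM0
  have hnorm : ∀ j : ℕ, ‖ζ ^ j‖ ≤ 1 := fun j => by
    rw [norm_pow, Complex.norm_eq_one_of_pow_eq_one hζ.pow_eq_one hM0, one_pow]
  set b : ℕ → ℂ := fun k => ((N - k : ℕ) : ℂ) * (fourierWeight k * ⟪h, (T ^ k) h⟫_ℂ) with hb
  have hbN : ∀ k, N ≤ k → b k = 0 := fun k hk => by simp [hb, Nat.sub_eq_zero_of_le hk]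
  have hpeval : ∀ z, p.eval z = ∑ k ∈ range R, p.coeff k * z ^ k := fun z =>
    Polynomial.eval_eq_sum_range' (by omega) z
  have hG : ∀ j, 0 ≤ (∑ k ∈ range R, b k * (starRingEnd ℂ (ζ ^ j)) ^ k).re := by
    intro j
    have hT' : ‖(starRingEnd ℂ (ζ ^ j)) • T‖ ≤ 1 := by
      rw [norm_smul, RCLike.norm_conj]
      exact mul_le_one₀ (hnorm j) (norm_nonneg _) hT
    have h1 := fejer_nonneg hT' h N
    convert h1 using 2
    rw [← sum_subset (range_subset_range.2 (by omega : N ≤ R))]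
    · refine sum_congr rfl fun k _ => ?_
      rw [smul_pow, smul_apply, inner_smul_right]
      simp only [hb]
      ring
    · intro k _ hk
      rw [hbN k (not_lt.1 fun hlt => hk (mem_range.2 hlt)), zero_mul]
  have hsum : 0 ≤ ∑ j ∈ range M, 2 * ((p.eval (ζ ^ j)).re *
      (∑ k ∈ range R, b k * (starRingEnd ℂ (ζ ^ j)) ^ k).re) :=
    sum_nonneg fun j _ => mul_nonneg two_pos.le (mul_nonneg (hp _ (hnorm j)) (hG j))
  have hre : ∀ x y : ℂ, 2 * (x.re * y.re) = (x * y + x * starRingEnd ℂ y).re := by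
    intro x y
    simp
    ring
  have hconj : ∀ j, starRingEnd ℂ (∑ k ∈ range R, b k * (starRingEnd ℂ (ζ ^ j)) ^ k) =
      ∑ k ∈ range R, starRingEnd ℂ (b k) * (ζ ^ j) ^ k := by
    intro j
    rw [map_sum]
    simp
  simp_rw [hre] at hsum
  rw [← Complex.re_sum, sum_add_distrib] at hsum
  simp_rw [hconj, hpeval] at hsum
  rw [sum_eval_mul_eval_conj hζ (by omega), sum_eval_mul_eval hζ le_rfl (by omega)] at hsum
  have hb0 : starRingEnd ℂ (b 0) = b 0 := by
    simp [hb, inner_self_eq_norm_sq_to_K]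
  -- The extra constant term doubles the weight `1` at `k = 0`, matching the weight `2` elsewhere.
  have hfin : ∑ k ∈ range R, p.coeff k * b k + p.coeff 0 * b 0 =
      2 * ∑ k ∈ range N, ((N - k : ℕ) : ℂ) * (p.coeff k * ⟪h, (T ^ k) h⟫_ℂ) := by
    rw [← sum_subset (range_subset_range.2 (by omega : N ≤ R))]
    · cases N with
      | zero => simp [hbN]
      | succ N =>
        rw [sum_range_succ', sum_range_succ', mul_add, mul_sum, add_assoc]
        congr 1
        · refine sum_congr rfl fun k _ => ?_
          simp only [hb, fourierWeight, if_neg (Nat.succ_ne_zero k)]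
          push_cast
          ring
        · simp only [hb, fourierWeight, if_true]
          push_cast
          ring
    · intro k _ hk
      rw [hbN k (not_lt.1 fun hlt => hk (mem_range.2 hlt)), mul_zero]
  rw [hb0, ← mul_add, hfin, re_natCast_mul, show (2 : ℂ) = ((2 : ℝ) : ℂ) by norm_num,
    Complex.re_ofReal_mul] at hsum
  have hMpos : (0 : ℝ) < M := by exact_mod_cast Nat.pos_of_ne_zero hM0
  have h2 := nonneg_of_mul_nonneg_right (nonneg_of_mul_nonneg_right hsum hMpos) two_pos
  rw [Complex.re_sum] at h2
  simpa only [re_natCast_mul] using h2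

end Fejer

/-! ### Toeplitz forms and Harnack domination -/

section Kernel

open Finset

variable {H : Type*} [NormedAddCommGroup H] [InnerProductSpace ℂ H]

/-- The Toeplitz form of `T` at a finitely supported sequence `h`, which is the squared norm of
`∑ Vⁿ hₙ` for an isometric dilation `V` of `T`. -/
noncomputable def toeplitzForm (T : H →L[ℂ] H) (N : ℕ) (h : ℕ → H) : ℝ :=
  ∑ k ∈ range N, fourierWeight k * ∑ m ∈ range N, (⟪h m, (T ^ k) (h (m + k))⟫_ℂ).re

/-- Row by row, `2 Re ⟪h m, s m⟫ - ‖h m‖² = ‖s m‖² - ‖s m - h m‖²`. -/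
theorem toeplitzForm_eq (T : H →L[ℂ] H) {N : ℕ} {h s : ℕ → H}
    (hs : ∀ m, ∑ k ∈ range N, (T ^ k) (h (m + k)) = s m) :
    toeplitzForm T N h = ∑ m ∈ range N, (‖s m‖ ^ 2 - ‖s m - h m‖ ^ 2) := by
  rw [toeplitzForm]
  simp_rw [mul_sum]
  rw [sum_comm]
  refine sum_congr rfl fun m hm => ?_
  obtain ⟨n, rfl⟩ : ∃ n, N = n + 1 := ⟨N - 1, by have := mem_range.1 hm; omega⟩
  have h1 : (⟪h m, s m⟫_ℂ).re =
      ∑ k ∈ range (n + 1), (⟪h m, (T ^ k) (h (m + k))⟫_ℂ).re := by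
    rw [← hs m, inner_sum, Complex.re_sum]
  have h2 : (⟪h m, h m⟫_ℂ).re = ‖h m‖ ^ 2 := inner_self_eq_norm_sq (𝕜 := ℂ) (h m)
  have h3 := norm_sub_sq (𝕜 := ℂ) (s m) (h m)
  rw [inner_re_symm, RCLike.re_to_complex, h1] at h3
  rw [h3, sum_range_succ', sum_range_succ']
  simp only [fourierWeight, Nat.succ_ne_zero, if_false, if_true, pow_zero, add_zero,
    one_apply_eq_self, h2, ← mul_sum]
  ring

/-- The tails satisfy `s m - h m = T (s (m + 1))`, so contractivity bounds the form below by a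
telescoping sum. -/
theorem norm_sq_le_toeplitzForm {T : H →L[ℂ] H} (hT : ‖T‖ ≤ 1) {N : ℕ} {h : ℕ → H}
    (hN : ∀ n, N ≤ n → h n = 0) :
    ‖∑ k ∈ range N, (T ^ k) (h k)‖ ^ 2 ≤ toeplitzForm T N h := by
  set s : ℕ → H := fun m => ∑ k ∈ range N, (T ^ k) (h (m + k)) with hs
  rw [toeplitzForm_eq T (s := s) fun m => rfl]
  have hrec : ∀ m, s m - h m = T (s (m + 1)) := by
    intro m
    have h1 : s m = ∑ k ∈ range (N + 1), (T ^ k) (h (m + k)) := by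
      rw [sum_range_succ, hN (m + N) (by omega), map_zero, add_zero]
    rw [h1, sum_range_succ', hs, map_sum, sub_eq_iff_eq_add]
    congr 1
    refine sum_congr rfl fun k _ => ?_
    rw [pow_succ', add_right_comm m 1 k, add_assoc]
    rfl
  have hsN : s N = 0 := sum_eq_zero fun k _ => by rw [hN _ (by omega), map_zero]
  have h0 : ∑ k ∈ range N, (T ^ k) (h k) = s 0 := by simp [hs]
  have h2 : ∑ m ∈ range N, (‖s m‖ ^ 2 - ‖s (m + 1)‖ ^ 2) = ‖s 0‖ ^ 2 - ‖s N‖ ^ 2 :=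
    sum_range_sub' (fun m => ‖s m‖ ^ 2) N
  rw [hsN, norm_zero] at h2
  rw [h0]
  calc ‖s 0‖ ^ 2 = ∑ m ∈ range N, (‖s m‖ ^ 2 - ‖s (m + 1)‖ ^ 2) := by rw [h2]; ring
    _ ≤ _ := by
      refine sum_le_sum fun m _ => ?_
      rw [hrec]
      exact sub_le_sub_left
        (pow_le_pow_left₀ (norm_nonneg _) (norm_apply_le_of_contraction hT _) 2) _

theorem toeplitzForm_sub_apply (T : H →L[ℂ] H) {N : ℕ} {s : ℕ → H} (hs0 : s 0 = 0)
    (hN : ∀ n, N ≤ n → s n = 0) :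
    toeplitzForm T N (fun m => s m - T (s (m + 1))) =
      ∑ m ∈ range N, (‖s (m + 1)‖ ^ 2 - ‖T (s (m + 1))‖ ^ 2) := by
  have h1 : ∀ m, ∑ k ∈ range N, (T ^ k) (s (m + k) - T (s (m + k + 1))) = s m := by
    intro m
    have h2 : ∀ k, (T ^ k) (s (m + k) - T (s (m + k + 1))) =
        (T ^ k) (s (m + k)) - (T ^ (k + 1)) (s (m + (k + 1))) := by
      intro k
      rw [map_sub, pow_succ]
      rfl
    rw [sum_congr rfl fun k _ => h2 k, sum_range_sub' (fun k => (T ^ k) (s (m + k))),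
      hN (m + N) (by omega)]
    simp
  rw [toeplitzForm_eq T h1]
  simp only [sub_sub_cancel]
  rw [sum_sub_distrib, sum_sub_distrib]
  congr 1
  have h3 := sum_range_sub' (fun m => ‖s m‖ ^ 2) N
  rw [hs0, hN N le_rfl, sub_self, sum_sub_distrib] at h3
  linarith

/-- Averaging over the roots of unity turns scalar polynomials into Toeplitz forms. -/
theorem sum_re_inner_aeval_fejerPoly (T : H →L[ℂ] H) {M N L : ℕ} {ζ : ℂ}
    (hζ : IsPrimitiveRoot ζ M) (hM : N + L ≤ M) {h : ℕ → H} (hN : ∀ n, N ≤ n → h n = 0) :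
    ∑ j ∈ range M, (⟪∑ n ∈ range N, (ζ ^ j) ^ n • h n,
        (Polynomial.aeval T (fejerPoly L (starRingEnd ℂ (ζ ^ j))))
          (∑ n ∈ range N, (ζ ^ j) ^ n • h n)⟫_ℂ).re =
      M * ∑ k ∈ range L, ((L - k : ℕ) : ℝ) *
        (fourierWeight k * ∑ m ∈ range N, (⟪h m, (T ^ k) (h (m + k))⟫_ℂ).re) := by
  have h1 : ∀ j, ⟪∑ n ∈ range N, (ζ ^ j) ^ n • h n,
        (Polynomial.aeval T (fejerPoly L (starRingEnd ℂ (ζ ^ j))))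
          (∑ n ∈ range N, (ζ ^ j) ^ n • h n)⟫_ℂ =
      ∑ k ∈ range L, ∑ m ∈ range N, ∑ n ∈ range N, ((L - k : ℕ) : ℂ) * (fourierWeight k *
        ⟪h m, (T ^ k) (h n)⟫_ℂ) * ((ζ ^ j) ^ n * (starRingEnd ℂ (ζ ^ j)) ^ (m + k)) := by
    intro j
    rw [inner_aeval_fejerPoly]
    refine sum_congr rfl fun k _ => ?_
    simp only [map_sum, sum_inner, inner_sum, map_smul, inner_smul_left, inner_smul_right, mul_sum,
      map_pow]
    rw [sum_comm]
    refine sum_congr rfl fun m _ => sum_congr rfl fun n _ => ?_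
    ring
  have h2 : ∑ j ∈ range M, ⟪∑ n ∈ range N, (ζ ^ j) ^ n • h n,
        (Polynomial.aeval T (fejerPoly L (starRingEnd ℂ (ζ ^ j))))
          (∑ n ∈ range N, (ζ ^ j) ^ n • h n)⟫_ℂ =
      M * ∑ k ∈ range L, ((L - k : ℕ) : ℂ) *
        (fourierWeight k * ∑ m ∈ range N, ⟪h m, (T ^ k) (h (m + k))⟫_ℂ) := by
    rw [sum_congr rfl fun j _ => h1 j, sum_comm, mul_sum]
    refine sum_congr rfl fun k hk => ?_
    rw [sum_comm, mul_sum, mul_sum, mul_sum]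
    refine sum_congr rfl fun m hm => ?_
    rw [sum_comm]
    have hk' := mem_range.1 hk
    have hm' := mem_range.1 hm
    have h3 : ∀ n ∈ range N, ∑ j ∈ range M, ((L - k : ℕ) : ℂ) * (fourierWeight k *
        ⟪h m, (T ^ k) (h n)⟫_ℂ) * ((ζ ^ j) ^ n * (starRingEnd ℂ (ζ ^ j)) ^ (m + k)) =
        if n = m + k then M * (((L - k : ℕ) : ℂ) * (fourierWeight k *
          ⟪h m, (T ^ k) (h (m + k))⟫_ℂ)) else 0 := by
      intro n hn
      have hn' := mem_range.1 hn
      rw [← mul_sum, sum_pow_mul_conj_pow hζ n (m + k) (by omega) (by omega)]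
      split_ifs with hnk
      · rw [hnk]; ring
      · ring
    rw [sum_congr rfl h3, sum_ite_eq']
    split_ifs with hmk
    · rfl
    · rw [hN (m + k) (not_lt.1 fun hlt => hmk (mem_range.2 hlt))]
      simp
  rw [← Complex.re_sum, h2, re_natCast_mul, Complex.re_sum]
  congr 1
  refine sum_congr rfl fun k _ => ?_
  rw [re_natCast_mul, Complex.re_ofReal_mul, Complex.re_sum]

/-- The domination is applied to Fejér polynomials at the vectors `∑ ζʲⁿ h n` and averaged over `j`.
This makes every Fejér mean of `c Q_{T'} - Q_T` nonnegative, hence the full sum. -/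
theorem toeplitzForm_le {T T' : H →L[ℂ] H} {c : ℝ}
    (hc : ∀ p : Polynomial ℂ, (∀ z : ℂ, ‖z‖ ≤ 1 → 0 ≤ (p.eval z).re) → ∀ x : H,
      (⟪x, (Polynomial.aeval T p) x⟫_ℂ).re ≤ c * (⟪x, (Polynomial.aeval T' p) x⟫_ℂ).re)
    {N : ℕ} {h : ℕ → H} (hN : ∀ n, N ≤ n → h n = 0) :
    toeplitzForm T N h ≤ c * toeplitzForm T' N h := by
  set y : (H →L[ℂ] H) → ℕ → ℝ := fun S k =>
    fourierWeight k * ∑ m ∈ range N, (⟪h m, (S ^ k) (h (m + k))⟫_ℂ).re with hy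
  have key : 0 ≤ ∑ k ∈ range N, (c * y T' k - y T k) := by
    refine sum_nonneg_of_fejer_nonneg (fun k hk => ?_) fun L => ?_
    · have h0 : ∀ S : H →L[ℂ] H, y S k = 0 := by
        intro S
        simp only [hy]
        rw [sum_eq_zero, mul_zero]
        intro m _
        rw [hN (m + k) (by omega), map_zero, inner_zero_right, Complex.zero_re]
      rw [h0, h0, mul_zero, sub_zero]
    · set M := N + L + 1 with hM
      have hM0 : M ≠ 0 := by omega
      have hζ := Complex.isPrimitiveRoot_exp M hM0
      set ζ := Complex.exp (2 * Real.pi * Complex.I / M)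
      have hsum : ∀ j ∈ range M, (⟪∑ n ∈ range N, (ζ ^ j) ^ n • h n,
          (Polynomial.aeval T (fejerPoly L (starRingEnd ℂ (ζ ^ j))))
            (∑ n ∈ range N, (ζ ^ j) ^ n • h n)⟫_ℂ).re ≤
          c * (⟪∑ n ∈ range N, (ζ ^ j) ^ n • h n,
          (Polynomial.aeval T' (fejerPoly L (starRingEnd ℂ (ζ ^ j))))
            (∑ n ∈ range N, (ζ ^ j) ^ n • h n)⟫_ℂ).re := by
        intro j _
        refine hc _ (fun z hz => fejerPoly_eval_re_nonneg L ?_ hz) _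
        rw [RCLike.norm_conj, norm_pow, Complex.norm_eq_one_of_pow_eq_one hζ.pow_eq_one hM0,
          one_pow]
      have h1 := sum_le_sum hsum
      rw [← mul_sum, sum_re_inner_aeval_fejerPoly T hζ (by omega) hN,
        sum_re_inner_aeval_fejerPoly T' hζ (by omega) hN, mul_left_comm c] at h1
      have hMpos : (0 : ℝ) < M := by exact_mod_cast Nat.pos_of_ne_zero hM0
      have h2 := le_of_mul_le_mul_left h1 hMpos
      rw [mul_sum, ← sub_nonneg, ← sum_sub_distrib] at h2
      refine h2.trans_eq (sum_congr rfl fun k _ => ?_)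
      simp only [hy]
      ring
  rw [sum_sub_distrib, ← mul_sum] at key
  exact sub_nonneg.1 key

theorem norm_sq_sum_pow_apply_sub_le {T T' : H →L[ℂ] H} (hT : ‖T‖ ≤ 1) {c : ℝ}
    (hc : ∀ p : Polynomial ℂ, (∀ z : ℂ, ‖z‖ ≤ 1 → 0 ≤ (p.eval z).re) → ∀ x : H,
      (⟪x, (Polynomial.aeval T p) x⟫_ℂ).re ≤ c * (⟪x, (Polynomial.aeval T' p) x⟫_ℂ).re)
    (N : ℕ) (g : ℕ → H) :
    ‖∑ k ∈ range N, (T ^ k) ((T - T') (g k))‖ ^ 2 ≤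
      c * ∑ k ∈ range N, (‖g k‖ ^ 2 - ‖T' (g k)‖ ^ 2) := by
  -- Shifting `g` by one place gives `s 0 = 0`, so that `Tᵏ⁺¹ s (k + 1)` pairs with `Tᵏ T' s (k +
  -- 1)` to give `Tᵏ (T - T') g k`.
  set s : ℕ → H := fun m => if m = 0 ∨ N < m then 0 else g (m - 1) with hs
  have hs0 : s 0 = 0 := by simp [hs]
  have hsN : ∀ n, N + 1 ≤ n → s n = 0 := fun n hn => if_pos (Or.inr hn)
  have hsg : ∀ k ∈ range N, s (k + 1) = g k := by
    intro k hk
    have hk' := mem_range.1 hk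
    simp only [hs]
    rw [if_neg (by omega), Nat.add_sub_cancel]
  have hhN : ∀ n, N + 1 ≤ n → s n - T' (s (n + 1)) = 0 := by
    intro n hn
    rw [hsN n hn, hsN (n + 1) (by omega), map_zero, sub_zero]
  have h1 := (norm_sq_le_toeplitzForm hT hhN).trans (toeplitzForm_le hc hhN)
  rw [toeplitzForm_sub_apply T' hs0 hsN] at h1
  have h2 : ∑ k ∈ range (N + 1), (T ^ k) (s k - T' (s (k + 1))) =
      ∑ k ∈ range N, (T ^ k) ((T - T') (g k)) := by
    simp only [map_sub, sum_sub_distrib]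
    rw [sum_range_succ' (fun k => (T ^ k) (s k)),
      sum_range_succ (fun k => (T ^ k) (T' (s (k + 1)))),
      hs0, hsN (N + 1) le_rfl]
    simp only [map_zero, add_zero, sub_apply, map_sub, sum_sub_distrib]
    congr 1
    · refine sum_congr rfl fun k hk => ?_
      rw [hsg k hk, pow_succ]
      rfl
    · exact sum_congr rfl fun k hk => by rw [hsg k hk]
  rw [h2, sum_range_succ _ N, hsN (N + 1) le_rfl] at h1
  refine h1.trans_eq ?_
  congr 1
  simp only [map_zero, norm_zero, sub_self, add_zero]
  exact sum_congr rfl fun k hk => by rw [hsg k hk]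

end Kernel

/-! ### Construction of the intertwining operator -/

section Intertwining

open Finset

variable {H : Type*} [NormedAddCommGroup H] [InnerProductSpace ℂ H] [CompleteSpace H]

theorem memℓp_two_of_sum_le {E : Type*} [NormedAddCommGroup E] {f : ℕ → E} {C : ℝ}
    (h : ∀ N, ∑ n ∈ range N, ‖f n‖ ^ 2 ≤ C) : Memℓp f 2 := by
  refine memℓp_gen ?_
  simp only [ENNReal.toReal_ofNat, Real.rpow_ofNat]
  exact summable_of_sum_range_le (fun _ => sq_nonneg _) h

/-- A row `(S₀, S₁, …)` that is bounded on finitely supported sequences is a bounded operator. -/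
theorem exists_adjoint_apply_eq {E : Type*} [NormedAddCommGroup E] [InnerProductSpace ℂ E]
    [CompleteSpace E] (S : ℕ → H →L[ℂ] E) {C : ℝ} (hC : 0 ≤ C)
    (hS : ∀ h N, ∑ n ∈ range N, ‖S n h‖ ^ 2 ≤ (C * ‖h‖) ^ 2) :
    ∃ B : SeqSpace E →L[ℂ] H, ∀ h n, B.adjoint h n = S n h := by
  let R : H →ₗ[ℂ] SeqSpace E :=
    { toFun := fun h => ⟨fun n => S n h, memℓp_two_of_sum_le (hS h)⟩
      map_add' := fun x y => by
        ext n
        exact map_add (S n) x y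
      map_smul' := fun a x => by
        ext n
        exact map_smul (S n) a x }
  have hR : ∀ h, ‖R h‖ ≤ C * ‖h‖ := by
    intro h
    refine lp.norm_le_of_forall_sum_le (by norm_num) (by positivity) fun s => ?_
    simp only [ENNReal.toReal_ofNat, Real.rpow_ofNat]
    obtain ⟨N, hN⟩ := s.exists_nat_subset_range
    exact (sum_le_sum_of_subset_of_nonneg hN fun _ _ _ => sq_nonneg _).trans (hS h N)
  refine ⟨(R.mkContinuous C hR).adjoint, fun h n => ?_⟩
  rw [ContinuousLinearMap.adjoint_adjoint]
  rfl

/-- `B` is the row `(B₀, T B₀, T² B₀, …)`; the hypothesis bounds its adjoint column. -/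
theorem exists_comp_shift_eq {E : Type*} [NormedAddCommGroup E] [InnerProductSpace ℂ E]
    [CompleteSpace E] (T : H →L[ℂ] H) (B₀ : E →L[ℂ] H) {C : ℝ} (hC : 0 ≤ C)
    (hB₀ : ∀ h N, ∑ n ∈ range N, ‖B₀.adjoint ((T.adjoint ^ n) h)‖ ^ 2 ≤ (C * ‖h‖) ^ 2) :
    ∃ B : SeqSpace E →L[ℂ] H, B ∘L inclZero E = B₀ ∧ B ∘L shift E = T ∘L B := by
  obtain ⟨B, hB⟩ := exists_adjoint_apply_eq (fun n => B₀.adjoint ∘L (T.adjoint ^ n)) hC hB₀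
  refine ⟨B, ?_, ?_⟩
  · ext x
    refine ext_inner_right ℂ fun h => ?_
    rw [ContinuousLinearMap.comp_apply, ← ContinuousLinearMap.adjoint_inner_right]
    refine (lp.inner_single_left (𝕜 := ℂ) 0 x (B.adjoint h)).trans ?_
    rw [hB, ContinuousLinearMap.comp_apply, pow_zero, ContinuousLinearMap.adjoint_inner_right]
    rfl
  · ext x
    refine ext_inner_right ℂ fun h => ?_
    rw [ContinuousLinearMap.comp_apply, ContinuousLinearMap.comp_apply,
      ← ContinuousLinearMap.adjoint_inner_right, ← ContinuousLinearMap.adjoint_inner_right T,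
      ← ContinuousLinearMap.adjoint_inner_right B]
    have h1 := lp.hasSum_inner (𝕜 := ℂ) (shift E x) (B.adjoint h)
    have h2 := lp.hasSum_inner (𝕜 := ℂ) x (B.adjoint (T.adjoint h))
    rw [← hasSum_nat_add_iff' 1] at h1
    simp only [sum_range_one, shift_apply_zero, inner_zero_left, sub_zero, shift_apply_succ, hB,
      ContinuousLinearMap.comp_apply] at h1 h2
    simp only [pow_succ, ContinuousLinearMap.mul_def, ContinuousLinearMap.comp_apply] at h1
    exact h1.unique h2

theorem exists_shift_intertwining {T T' : H →L[ℂ] H} (hT : ‖T‖ ≤ 1) (hT' : ‖T'‖ ≤ 1) {c : ℝ}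
    (hc0 : 0 ≤ c)
    (hc : ∀ p : Polynomial ℂ, (∀ z : ℂ, ‖z‖ ≤ 1 → 0 ≤ (p.eval z).re) → ∀ x : H,
      (⟪x, (Polynomial.aeval T p) x⟫_ℂ).re ≤ c * (⟪x, (Polynomial.aeval T' p) x⟫_ℂ).re) :
    ∃ B : SeqSpace (defectSpace T') →L[ℂ] H,
      T = T' + B ∘L inclZero (defectSpace T') ∘L defectMap T' ∧
        B ∘L shift (defectSpace T') = T ∘L B := by
  have hmain : ∀ N (g : ℕ → H), ‖∑ k ∈ range N, (T ^ k) ((T - T') (g k))‖ ^ 2 ≤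
      c * ∑ k ∈ range N, ‖defectMap T' (g k)‖ ^ 2 := by
    intro N g
    refine (norm_sq_sum_pow_apply_sub_le hT hc N g).trans_eq ?_
    congr 1
    exact sum_congr rfl fun k _ => by rw [norm_defectMap, norm_defectOp_sq hT']
  -- The case `N = 1` of the row estimate is the Douglas condition.
  obtain ⟨B₀, hB₀⟩ := exists_comp_defectMap_eq T' (T - T') (C := √c) (by
    intro h
    refine le_of_sq_le_sq ?_ (by positivity)
    rw [mul_pow, Real.sq_sqrt hc0]
    simpa using hmain 1 fun _ => h)
  have hdense : ∀ N (x : ℕ → defectSpace T'), ‖∑ k ∈ range N, (T ^ k) (B₀ (x k))‖ ^ 2 ≤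
      c * ∑ k ∈ range N, ‖x k‖ ^ 2 := by
    intro N x
    refine (DenseRange.piMap fun _ : ℕ => denseRange_defectMap T').induction_on (p := fun x =>
      ‖∑ k ∈ range N, (T ^ k) (B₀ (x k))‖ ^ 2 ≤ c * ∑ k ∈ range N, ‖x k‖ ^ 2) x ?_ ?_
    · exact isClosed_le (by fun_prop) (by fun_prop)
    · intro g
      have := hmain N g
      rw [← hB₀] at this
      exact this
  have hsum : ∀ h N, ∑ n ∈ range N, ‖B₀.adjoint ((T.adjoint ^ n) h)‖ ^ 2 ≤ (√c * ‖h‖) ^ 2 := by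
    intro h N
    -- Duality: testing the row on its own adjoint column gives `S ≤ √(c S) ‖h‖`, hence `S ≤ c
    -- ‖h‖²`.
    set x : ℕ → defectSpace T' := fun n => B₀.adjoint ((T.adjoint ^ n) h) with hx
    have h1 := hdense N x
    have h2 : ∑ n ∈ range N, ‖x n‖ ^ 2 = (⟪∑ k ∈ range N, (T ^ k) (B₀ (x k)), h⟫_ℂ).re := by
      rw [sum_inner, Complex.re_sum]
      refine sum_congr rfl fun n _ => ?_
      rw [← ContinuousLinearMap.adjoint_inner_right, ← ContinuousLinearMap.star_eq_adjoint,
        star_pow, ContinuousLinearMap.star_eq_adjoint, ← ContinuousLinearMap.adjoint_inner_right]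
      exact (inner_self_eq_norm_sq (𝕜 := ℂ) (x n)).symm
    set S := ∑ n ∈ range N, ‖x n‖ ^ 2 with hS
    have hS0 : 0 ≤ S := sum_nonneg fun _ _ => sq_nonneg _
    have h3 : S ≤ ‖∑ k ∈ range N, (T ^ k) (B₀ (x k))‖ * ‖h‖ := by
      rw [h2]
      exact (Complex.re_le_norm _).trans (norm_inner_le_norm _ _)
    rw [mul_pow, Real.sq_sqrt hc0]
    rcases hS0.eq_or_lt with h0 | h0
    · rw [← h0]
      positivity
    · have h4 : S ^ 2 ≤ c * S * ‖h‖ ^ 2 := by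
        calc S ^ 2 ≤ (‖∑ k ∈ range N, (T ^ k) (B₀ (x k))‖ * ‖h‖) ^ 2 := pow_le_pow_left₀ hS0 h3 2
          _ ≤ c * S * ‖h‖ ^ 2 := by
            rw [mul_pow]
            gcongr
      nlinarith
  obtain ⟨B, hB, hBS⟩ := exists_comp_shift_eq T B₀ (Real.sqrt_nonneg c) hsum
  refine ⟨B, ?_, hBS⟩
  rw [← ContinuousLinearMap.comp_assoc, hB, hB₀, add_sub_cancel]

end Intertwining

/-! ### Harnack's inequality along an analytic arc -/

section Harnack

/-- Harnack's inequalities on the unit disc, for holomorphic functions with positive real part. -/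
theorem harnack_re_of_pos {f : ℂ → ℂ} (hf : DifferentiableOn ℂ f (Metric.ball 0 1))
    (hpos : ∀ z ∈ Metric.ball (0 : ℂ) 1, 0 < (f z).re) {z : ℂ} (hz : z ∈ Metric.ball (0 : ℂ) 1) :
    (1 - ‖z‖) * (f 0).re ≤ (1 + ‖z‖) * (f z).re ∧
      (1 - ‖z‖) * (f z).re ≤ (1 + ‖z‖) * (f 0).re := by
  have h0 := hpos 0 (Metric.mem_ball_self one_pos)
  set a := f 0 with ha
  have hne : ∀ w ∈ Metric.ball (0 : ℂ) 1, f w + starRingEnd ℂ a ≠ 0 := by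
    intro w hw h
    have h1 := congrArg Complex.re h
    rw [Complex.add_re, Complex.conj_re, Complex.zero_re] at h1
    linarith [hpos w hw]
  have hsq : ∀ w, ‖f w + starRingEnd ℂ a‖ ^ 2 - ‖f w - a‖ ^ 2 = 4 * ((f w).re * a.re) := by
    intro w
    rw [← Complex.normSq_eq_norm_sq, ← Complex.normSq_eq_norm_sq, Complex.normSq_apply,
      Complex.normSq_apply]
    simp only [Complex.add_re, Complex.add_im, Complex.sub_re, Complex.sub_im, Complex.conj_re,
      Complex.conj_im]
    ring
  -- The Cayley transform maps the right half-plane to the disc and `f 0` to `0`, so the Schwarz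
  -- lemma applies.
  set g : ℂ → ℂ := fun w => (f w - a) / (f w + starRingEnd ℂ a) with hg
  have hgd : DifferentiableOn ℂ g (Metric.ball 0 1) :=
    (hf.sub_const a).div (hf.add_const _) hne
  have hgm : Set.MapsTo g (Metric.ball 0 1) (Metric.closedBall 0 1) := by
    intro w hw
    rw [mem_closedBall_zero_iff, hg, norm_div, div_le_one (norm_pos_iff.2 (hne w hw))]
    refine le_of_sq_le_sq ?_ (norm_nonneg _)
    have := hsq w
    have h2 := mul_pos (hpos w hw) h0
    linarith
  have hg0 : g 0 = 0 := by simp [hg, ← ha]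
  have hgz : ‖g z‖ ≤ ‖z‖ :=
    Complex.norm_le_norm_of_mapsTo_ball hgd hgm hg0 (mem_ball_zero_iff.1 hz)
  have h1 : ‖f z - a‖ ≤ ‖z‖ * ‖f z + starRingEnd ℂ a‖ := by
    rwa [hg, norm_div, div_le_iff₀ (norm_pos_iff.2 (hne z hz))] at hgz
  have hz1 : ‖z‖ < 1 := mem_ball_zero_iff.1 hz
  have hu := hpos z hz
  -- The imaginary parts of `f z - a` and `f z + conj a` agree, so they may be dropped because `‖z‖
  -- ≤ 1`.
  have h2 : ((f z).re - a.re) ^ 2 ≤ (‖z‖ * ((f z).re + a.re)) ^ 2 := by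
    have h3 := pow_le_pow_left₀ (norm_nonneg _) h1 2
    rw [mul_pow, ← Complex.normSq_eq_norm_sq (f z - a),
      ← Complex.normSq_eq_norm_sq (f z + starRingEnd ℂ a), Complex.normSq_apply,
      Complex.normSq_apply] at h3
    simp only [Complex.add_re, Complex.add_im, Complex.sub_re, Complex.sub_im, Complex.conj_re,
      Complex.conj_im] at h3
    have h4 : ‖z‖ ^ 2 ≤ 1 := pow_le_one₀ (norm_nonneg _) hz1.le
    nlinarith [mul_nonneg (sub_nonneg.2 h4) (sq_nonneg ((f z).im - a.im))]
  have h5 := abs_le_of_sq_le_sq' h2 (by positivity)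
  constructor <;> nlinarith [h5.1, h5.2]

theorem harnack_re {f : ℂ → ℂ} (hf : DifferentiableOn ℂ f (Metric.ball 0 1))
    (hpos : ∀ z ∈ Metric.ball (0 : ℂ) 1, 0 ≤ (f z).re) {z : ℂ} (hz : z ∈ Metric.ball (0 : ℂ) 1) :
    (1 - ‖z‖) * (f 0).re ≤ (1 + ‖z‖) * (f z).re ∧
      (1 - ‖z‖) * (f z).re ≤ (1 + ‖z‖) * (f 0).re := by
  have key : ∀ ε : ℝ, 0 < ε →
      (1 - ‖z‖) * (f 0).re ≤ (1 + ‖z‖) * (f z).re + ε ∧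
      (1 - ‖z‖) * (f z).re ≤ (1 + ‖z‖) * (f 0).re + ε := by
    intro ε hε
    -- Adding `ε / 2` makes the real part strictly positive and costs `‖z‖ ε ≤ ε` in the inequality.
    have h1 := harnack_re_of_pos (f := fun w => f w + (ε / 2 : ℝ)) (hf.add_const _)
      (fun w hw => by
        rw [Complex.add_re, Complex.ofReal_re]
        linarith [hpos w hw]) hz
    simp only [Complex.add_re, Complex.ofReal_re] at h1
    have hz1 : ‖z‖ < 1 := mem_ball_zero_iff.1 hz
    constructor <;> nlinarith [h1.1, h1.2, norm_nonneg z]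
  exact ⟨le_of_forall_pos_le_add fun ε hε => (key ε hε).1,
    le_of_forall_pos_le_add fun ε hε => (key ε hε).2⟩

variable {H : Type*} [NormedAddCommGroup H] [InnerProductSpace ℂ H] [CompleteSpace H]

theorem realPart_le_smul_realPart_iff (X Y : H →L[ℂ] H) (c : ℝ) :
    (ℜ X : H →L[ℂ] H) ≤ c • (ℜ Y : H →L[ℂ] H) ↔
      ∀ x, (⟪x, X x⟫_ℂ).re ≤ c * (⟪x, Y x⟫_ℂ).re := by
  have hre : ∀ (Z : H →L[ℂ] H) x, (⟪(ℜ Z : H →L[ℂ] H) x, x⟫_ℂ).re = (⟪x, Z x⟫_ℂ).re := by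
    intro Z x
    have h1 : (⟪star Z x, x⟫_ℂ).re = (⟪x, Z x⟫_ℂ).re := by
      rw [ContinuousLinearMap.star_eq_adjoint, ContinuousLinearMap.adjoint_inner_left]
    have h2 : (⟪Z x, x⟫_ℂ).re = (⟪x, Z x⟫_ℂ).re := inner_re_symm (𝕜 := ℂ) _ _
    rw [realPart_apply_coe, smul_apply, add_apply, inner_smul_left_eq_smul, Complex.smul_re,
      inner_add_left, Complex.add_re, h1, h2, smul_eq_mul]
    ring
  have hsa : IsSelfAdjoint (c • (ℜ Y : H →L[ℂ] H) - (ℜ X : H →L[ℂ] H)) :=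
    ((IsSelfAdjoint.all c).smul (ℜ Y).2).sub (ℜ X).2
  rw [ContinuousLinearMap.le_def, ContinuousLinearMap.isPositive_def', and_iff_right hsa]
  refine forall_congr' fun x => ?_
  rw [ContinuousLinearMap.reApplyInnerSelf_apply, sub_apply, inner_sub_left, map_sub, sub_nonneg,
    smul_apply, inner_smul_left_eq_smul, RCLike.re_to_complex, RCLike.re_to_complex,
    Complex.smul_re, hre, hre, smul_eq_mul]

theorem harnackDominated_iff {T T' : H →L[ℂ] H} :
    HarnackDominated T T' ↔ ∃ c : ℝ, 1 ≤ c ∧ ∀ p : Polynomial ℂ,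
      (∀ z : ℂ, ‖z‖ ≤ 1 → 0 ≤ (p.eval z).re) → ∀ x : H,
        (⟪x, (Polynomial.aeval T p) x⟫_ℂ).re ≤ c * (⟪x, (Polynomial.aeval T' p) x⟫_ℂ).re := by
  simp only [HarnackDominated, realPart_le_smul_realPart_iff]

theorem harnackEquivalent_of_analytic_arc {F : ℂ → H →L[ℂ] H}
    (hF : AnalyticOnNhd ℂ F (Metric.ball 0 1)) (hF1 : ∀ z ∈ Metric.ball (0 : ℂ) 1, ‖F z‖ ≤ 1)
    {z₀ : ℂ} (hz₀ : z₀ ∈ Metric.ball (0 : ℂ) 1) : HarnackEquivalent (F 0) (F z₀) := by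
  have hz1 : ‖z₀‖ < 1 := mem_ball_zero_iff.1 hz₀
  have hpos : 0 < 1 - ‖z₀‖ := by linarith
  have hc : 1 ≤ (1 + ‖z₀‖) / (1 - ‖z₀‖) := by
    rw [one_le_div hpos]
    linarith [norm_nonneg z₀]
  have hd : ∀ (p : Polynomial ℂ) (x : H),
      DifferentiableOn ℂ (fun z => ⟪x, (Polynomial.aeval (F z) p) x⟫_ℂ) (Metric.ball 0 1) := by
    intro p x
    have hFd : DifferentiableOn ℂ F (Metric.ball 0 1) := hF.differentiableOn
    have h1 : DifferentiableOn ℂ (fun z => Polynomial.aeval (F z) p) (Metric.ball 0 1) := by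
      simp only [Polynomial.aeval_eq_sum_range]
      exact DifferentiableOn.fun_sum fun k _ => (hFd.fun_pow k).fun_const_smul _
    exact ((innerSL ℂ x).differentiable.comp_differentiableOn
      (h1.clm_apply (differentiableOn_const x)))
  have key := fun (p : Polynomial ℂ) (hp : ∀ z : ℂ, ‖z‖ ≤ 1 → 0 ≤ (p.eval z).re) (x : H) =>
    harnack_re (hd p x) (fun z hz => re_inner_aeval_nonneg (hF1 z hz) hp x) hz₀
  constructor <;> rw [harnackDominated_iff] <;> refine ⟨_, hc, fun p hp x => ?_⟩ <;>
    rw [div_mul_eq_mul_div, le_div_iff₀' hpos]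
  · exact (key p hp x).1
  · exact (key p hp x).2

end Harnack

end HarnackShmulyan

/-! ### The cycle of implications -/

theorem mainTheorem1 {H : Type*} [NormedAddCommGroup H] [InnerProductSpace ℂ H] [CompleteSpace H]
    (T T' : H →L[ℂ] H) (hT : ‖T‖ ≤ 1) (hT' : ‖T'‖ ≤ 1)
    (hqn : HarnackShmulyan.IsQuasiNormal T.adjoint)
    (hTT' : Commute T T')
    (hTT'T' : Commute T (T'.adjoint * T'))
    (hT'TT : Commute T' (T * T.adjoint)) :
    List.TFAE [
      HarnackShmulyan.HarnackDominated T T',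
      HarnackShmulyan.HarnackEquivalent T T',
      HarnackShmulyan.ShmulyanEquivalent T T',
      ∃ z₀ ∈ Metric.ball (0 : ℂ) 1, ∃ F : ℂ → H →L[ℂ] H,
        AnalyticOnNhd ℂ F (Metric.ball 0 1) ∧ (∀ z ∈ Metric.ball (0 : ℂ) 1, ‖F z‖ ≤ 1) ∧
          F 0 = T ∧ F z₀ = T',
      ∃ B : HarnackShmulyan.SeqSpace (HarnackShmulyan.defectSpace T') →L[ℂ] H,
        T = T' + B ∘L HarnackShmulyan.inclZero (HarnackShmulyan.defectSpace T') ∘L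
            HarnackShmulyan.defectMap T' ∧
          B ∘L HarnackShmulyan.shift (HarnackShmulyan.defectSpace T') = T ∘L B] := by
  tfae_have 2 → 1 := fun h => h.1
  tfae_have 1 → 5 := by
    intro h
    obtain ⟨c, hc, h⟩ := HarnackShmulyan.harnackDominated_iff.1 h
    exact HarnackShmulyan.exists_shift_intertwining hT hT' (zero_le_one.trans hc) h
  tfae_have 5 → 3 := by
    rintro ⟨B, hTB, hB⟩
    exact HarnackShmulyan.shmulyanEquivalent_of_shift_intertwining hT hT' hqn hTT' hTT'T' hT'TT
      hTB hB
  tfae_have 3 → 4 := fun h => h.exists_analytic_arc hT hT'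
  tfae_have 4 → 2 := by
    rintro ⟨z₀, hz₀, F, hF, hF1, rfl, rfl⟩
    exact HarnackShmulyan.harnackEquivalent_of_analytic_arc hF hF1 hz₀
  tfae_finish
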